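/- For integers $n,d,g\ge 1$, consider the computation of $U_1(U_2^{\top}V)$ from inputs $Q,K,V\in\mathbb{R}^{n\times d}$ ("Approximate Attention"), where $U_1,U_2\in\mathbb{R}^{n\times r}$ have as the entries of their $i$-th rows all monomials of degree at most $g$ in the $d$ entries of the $i$-th row of $Q$, respectively $K$. Write $\tau(w)=\binom{w+g}{g}$, so that $r=\tau(d)=\binom{d+g}{g}$. The computational DAG has as its nodes the entries of $Q,K,V,U_1,U_2$, of $H=U_2^{\top}V$ and of the output $U_1H$, together with all scalar products $U_2[i,a]\cdot V[i,j]$ and $U_1[i,a]\cdot H[a,j]$. Each entry of $U_1$ (of $U_2$) has as parents the entries of $Q$ (of $K$) occurring in its monomial, each scalar product has its two factors as parents, and each entry of $H$ and of the output is a single node whose parents are the scalar products that are summed up in it. I/O cost is measured in the red-blue pebble game with partial computations and re-computation. A fast memory holds at most $M$ values at any time, and a slow memory is unlimited; initially exactly the values of the source nodes are in slow memory and fast memory is empty. Loading a value from slow to fast memory, or saving it from fast to slow memory, costs $1$ each. At no cost, (i) a fully computed parent $u$ in fast memory that is not yet aggregated into the current value of its child $v$ can be aggregated into it, where the current value of $v$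 must be in fast memory, or $v$ has no current value and its computation is started by this step; afterwards the value of $v$ is in fast memory only; (ii) a value that is also in slow memory can be removed from fast memory; (iii) the value of a non-source node can be discarded altogether, after which the node can be computed again from scratch. At the end, the fully computed values of all sink nodes must be in slow memory. The optimal I/O cost $\mathrm{OPT}(n,d,g,M)$ is the minimum total cost of such a strategy. Case II is the asymptotic regime $M=o(d\cdot r)$ and $g=o(\log M)$; it is assumed as usual that $r\le n$. **Lemma.** In Case II, let $w$ be an integer (which may vary with the other parameters) with $g\le w\le d$ and $w\cdot\tau(w)\le\frac14 M$. Then the optimal I/O cost of Approximate Attention satisfies \[ \mathrm{OPT}(n,d,g,M)=O\!\left(n\cdot d\cdot\binom{\lfloor dg/w\rfloor}{g}\right)\qquad\text{and}\qquad \mathrm{OPT}(n,d,g,M)=\Omega\!\left(\frac{n\cdot r\cdot d\cdot w}{M}\right), \] with absolute constants in $O(\cdot)$ and $\Omega(\cdot)$: there are constants $c,C>0$ such that, for every family of parameters $(n,d,g,M,w)$ as above and every filter along which $M=o(d\cdot r)$ and $g=o(\log M)$, eventually an optimal strategy exists and $c\,\frac{n r d w}{M}\le \mathrm{OPT}(n,d,g,M)\le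 C\,n\,d\binom{\lfloor dg/w\rfloor}{g}$. -/

import Mathlib

open Filter Asymptotics

/-- `tau g w = C(w + g, g)`, the number of monomials of degree at most `g` in `w` variables. -/
def tau (g w : ℕ) : ℕ := (w + g).choose g

/-- `tau` written as the sum over the exact degrees `l = 0, …, g`. -/
theorem tau_eq_sum (g w : ℕ) (hw : 1 ≤ w) :
    tau g w = ∑ l ∈ Finset.range (g + 1), (w + l - 1).choose l := by
  induction g with
  | zero => simp [tau]
  | succ g ih =>
    rw [Finset.sum_range_succ, ← ih]
    unfold tau
    have h1 : w + (g + 1) - 1 = w + g := by omega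
    rw [h1, ← Nat.choose_succ_succ' (w + g) g]
    rfl

/-! ### The red-blue pebble game with partial computations (and re-computation) -/

/-- A configuration of the pebble game on the vertex set `V`.
* `red`: the vertices whose current value is in fast memory;
* `blue`: the vertices whose current value is in slow memory;
* `agg v`: the set of parents of `v` that are already aggregated into the current value of `v`
  (equivalently, the marked in-edges of `v`). -/
structure PebbleState (V : Type) where
  red : Finset V
  blue : Set V
  agg : V → Set V

section Game

variable {V : Type} [DecidableEq V]

/-- The set of parents of `v` in the directed graph `G`. -/
def parents (G : Digraph V) (v : V) : Set V := {u | G.Adj u v}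

/-- Vertices without parents: the inputs of the computation. -/
def IsSource (G : Digraph V) (v : V) : Prop := ∀ u, ¬ G.Adj u v

/-- Vertices without children: the outputs of the computation. -/
def IsSink (G : Digraph V) (v : V) : Prop := ∀ u, ¬ G.Adj v u

/-- All parents of `v` have been aggregated, so the current value of `v` is its final value. -/
def FullyComputed (G : Digraph V) (s : PebbleState V) (v : V) : Prop := s.agg v = parents G v

/-- The legal moves of the game; the natural number is the I/O cost of the move. -/
inductive PebbleMove (G : Digraph V) : PebbleState V → PebbleState V → ℕ → Prop
  /-- Load the value of `v` from slow memory into fast memory. -/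
  | load (s : PebbleState V) (v : V) (hv : v ∈ s.blue) :
      PebbleMove G s ⟨insert v s.red, s.blue, s.agg⟩ 1
  /-- Save the value of `v` from fast memory to slow memory. -/
  | save (s : PebbleState V) (v : V) (hv : v ∈ s.red) :
      PebbleMove G s ⟨s.red, insert v s.blue, s.agg⟩ 1
  /-- Aggregate the (final) value of the parent `u`, present in fast memory, into the value of `v`.
  The value of `v` is in fast memory, or the computation of `v` is only started by this move.
  A copy of `v` in slow memory becomes outdated. -/
  | compute (s : PebbleState V) (u v : V) (huv : G.Adj u v) (hu : u ∈ s.red)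
      (hfull : FullyComputed G s u) (hnew : u ∉ s.agg v)
      (hv : v ∈ s.red ∨ (v ∉ s.blue ∧ s.agg v = ∅)) :
      PebbleMove G s
        ⟨insert v s.red, s.blue \ {v}, Function.update s.agg v (insert u (s.agg v))⟩ 0
  /-- Remove from fast memory a value that is also present in slow memory. -/
  | delete (s : PebbleState V) (v : V) (hv : v ∈ s.red) (hv' : v ∈ s.blue) :
      PebbleMove G s ⟨s.red.erase v, s.blue, s.agg⟩ 0
  /-- Discard the value of a non-source vertex altogether; it may be computed again from scratch. -/
  | clear (s : PebbleState V) (v : V) (hv : ¬ IsSource G v) :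
      PebbleMove G s ⟨s.red.erase v, s.blue \ {v}, Function.update s.agg v ∅⟩ 0

/-- `PebbleRun G M s t c`: one can go from `s` to `t` by a finite sequence of moves of total I/O
cost `c`, with at most `M` values in fast memory after every move. -/
inductive PebbleRun (G : Digraph V) (M : ℕ) : PebbleState V → PebbleState V → ℕ → Prop
  | refl (s : PebbleState V) : PebbleRun G M s s 0
  | tail {s t t' : PebbleState V} {c k : ℕ} (hrun : PebbleRun G M s t c)
      (hmove : PebbleMove G t t' k) (hcap : t'.red.card ≤ M) : PebbleRun G M s t' (c + k)

/-- Initially exactly the sources are in slow memory, and fast memory is empty. -/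
def initialState (G : Digraph V) : PebbleState V := ⟨∅, {v | IsSource G v}, fun _ => ∅⟩

/-- At the end the final values of all sinks are in slow memory. -/
def IsFinal (G : Digraph V) (s : PebbleState V) : Prop :=
  ∀ v, IsSink G v → v ∈ s.blue ∧ FullyComputed G s v

/-- The I/O costs of all complete pebbling strategies with fast memory capacity `M`. -/
def ioCosts (G : Digraph V) (M : ℕ) : Set ℕ :=
  {c | ∃ t, PebbleRun G M (initialState G) t c ∧ IsFinal G t}

/-- `c` is the optimal I/O cost of the computation `G` with fast memory capacity `M`. -/
def IsOptimalIOCost (G : Digraph V) (M c : ℕ) : Prop := IsLeast (ioCosts G M) c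

end Game

/-! ### The computational DAG of Approximate Attention -/

/-- Exponent vectors of the monomials of degree at most `g` in `d` variables; they index the
columns of `U₁` and `U₂`. -/
abbrev Monomial (d g : ℕ) : Type := {a : Fin d → Fin (g + 1) // ∑ j, (a j : ℕ) ≤ g}

/-- The vertices of the DAG of `U₁ (U₂ᵀ V)`, for `n × d` inputs `Q`, `K`, `V`. -/
inductive AttnNode (n d g : ℕ) : Type
  /-- entry of the input `Q` -/
  | q (i : Fin n) (j : Fin d)
  /-- entry of the input `K` -/
  | k (i : Fin n) (j : Fin d)
  /-- entry of the input `V` -/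
  | v (i : Fin n) (j : Fin d)
  /-- entry of `U₁`: the monomial `a` in the entries of row `i` of `Q` -/
  | u₁ (i : Fin n) (a : Monomial d g)
  /-- entry of `U₂`: the monomial `a` in the entries of row `i` of `K` -/
  | u₂ (i : Fin n) (a : Monomial d g)
  /-- the product `U₂ i a * V i j` -/
  | mulUV (i : Fin n) (a : Monomial d g) (j : Fin d)
  /-- entry of `H = U₂ᵀ V` -/
  | h (a : Monomial d g) (j : Fin d)
  /-- the product `U₁ i a * H a j` -/
  | mulUH (i : Fin n) (a : Monomial d g) (j : Fin d)
  /-- entry of the output `U₁ H` -/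
  | out (i : Fin n) (j : Fin d)
  deriving DecidableEq

/-- The edges of the DAG of `U₁ (U₂ᵀ V)`. -/
inductive AttnEdge (n d g : ℕ) : AttnNode n d g → AttnNode n d g → Prop
  | q_u₁ (i : Fin n) (j : Fin d) (a : Monomial d g) (ha : a.1 j ≠ 0) :
      AttnEdge n d g (.q i j) (.u₁ i a)
  | k_u₂ (i : Fin n) (j : Fin d) (a : Monomial d g) (ha : a.1 j ≠ 0) :
      AttnEdge n d g (.k i j) (.u₂ i a)
  | u₂_mul (i : Fin n) (a : Monomial d g) (j : Fin d) :
      AttnEdge n d g (.u₂ i a) (.mulUV i a j)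
  | v_mul (i : Fin n) (a : Monomial d g) (j : Fin d) :
      AttnEdge n d g (.v i j) (.mulUV i a j)
  | mul_h (i : Fin n) (a : Monomial d g) (j : Fin d) :
      AttnEdge n d g (.mulUV i a j) (.h a j)
  | u₁_mul (i : Fin n) (a : Monomial d g) (j : Fin d) :
      AttnEdge n d g (.u₁ i a) (.mulUH i a j)
  | h_mul (i : Fin n) (a : Monomial d g) (j : Fin d) :
      AttnEdge n d g (.h a j) (.mulUH i a j)
  | mul_out (i : Fin n) (a : Monomial d g) (j : Fin d) :
      AttnEdge n d g (.mulUH i a j) (.out i j)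

/-- The computational DAG of Approximate Attention with sequence length `n`, feature dimension `d`
and polynomial degree `g`. -/
def attentionDAG (n d g : ℕ) : Digraph (AttnNode n d g) := ⟨AttnEdge n d g⟩

/-! Write r = τ(d) and B = ⌊dg/w⌋.

Lower bound. The potential is the number of products U₁[i,a]·H[a,j] contained in the current
outputs; it rises from 0 to n·r·d. A run is cut into segments of cost at most M
(`PebbleRun.potential_le`), and a segment adds only O(M²/w) to the potential (`outProgress_le_add`).
In a segment at most 2M values are present at the start or loaded, and at most 2M outputs receive
products that survive. Unlike in plain matrix multiplication, few variables yield many monomials,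
since entries of U₁ and U₂ can be formed anew from the inputs. Hence rows are split by whether at
least w of the loaded values belong to them. There are O(M/w) heavy rows, each meeting at most 2M
loaded entries of H. A light row offers at most w + τ(w) monomials to each of its outputs, and
w·τ(w) ≤ M/4 makes this O(M²/w) as well. An entry of H that is computed within the segment needs a
contribution from every one of the n rows of K and V, so there are few of them (`card_scratch_le`),
given r ≤ n.

Upper bound. Every monomial is assigned to a set S of variables from a family F that covers all sets
of at most g variables, where |S| = O(w) and τ(|S|) = O(τ(w)). For a block of about w/16 columns,
the part of H with monomials assigned to S fits into fast memory. A phase streams the rows of K and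
V to build this part, then streams the rows of Q and the outputs to use it up, and discards it;
monomials are formed on the fly, and H is never saved. A phase costs O(n·w) and there are O(|F|·d/w)
phases, so the total is O(n·d·|F|) (`exists_mem_ioCosts`).

It remains to find F with |F| = O(C(B,g)) (`exists_cover`). If g² ≤ w, cut the variables into B
intervals and take all unions of g of them. If w ≤ g², take a greedy cover by w-sets: it loses a
factor O(w), but C(d,g)/C(w,g) is smaller than C(B,g) by a factor of order g², which pays for the
loss.

The regime enters in two ways. M = o(d·r) makes the last, incomplete segment negligible and forces B
≥ g + 2, while g = o(log M) allows w to be raised to 8g. -/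

/-! ### Counting monomials -/

/-- The variables that occur in the monomial `a`. -/
def Monomial.support {d g : ℕ} (a : Monomial d g) : Finset (Fin d) :=
  Finset.univ.filter fun j => a.1 j ≠ 0

theorem Monomial.mem_support {d g : ℕ} {a : Monomial d g} {j : Fin d} :
    j ∈ a.support ↔ a.1 j ≠ 0 := by simp [Monomial.support]

theorem Monomial.card_support_le {d g : ℕ} (a : Monomial d g) : a.support.card ≤ g := by
  refine le_trans ?_ a.2
  rw [Finset.card_eq_sum_ones, Monomial.support, Finset.sum_filter]
  refine Finset.sum_le_sum fun j _ => ?_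
  split_ifs with h
  · exact Nat.one_le_iff_ne_zero.2 fun h0 => h (Fin.ext h0)
  · exact Nat.zero_le _

/-- The monomials of degree at most `g` in the variables from `S`. -/
def monomialsIn {d : ℕ} (g : ℕ) (S : Finset (Fin d)) : Finset (Monomial d g) :=
  Finset.univ.filter fun a => a.support ⊆ S

theorem mem_monomialsIn {d g : ℕ} {S : Finset (Fin d)} {a : Monomial d g} :
    a ∈ monomialsIn g S ↔ a.support ⊆ S := by simp [monomialsIn]

/-- Stars and bars: the extra element `none` carries the slack g - deg, which turns degree at most g
into degree exactly g. -/
theorem card_monomialsIn {d : ℕ} (g : ℕ) (S : Finset (Fin d)) :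
    (monomialsIn g S).card = tau g S.card := by
  have h := Finset.card_finsuppAntidiag_nat_eq_choose (s := Finset.insertNone S) g
  rw [Finset.card_insertNone, show S.card + 1 + g - 1 = S.card + g by omega] at h
  rw [tau, ← h]
  refine Finset.card_bij'
    (fun a _ => Finsupp.equivFunOnFinite.symm
      (fun o : Option (Fin d) => o.elim (g - ∑ j, (a.1 j : ℕ)) fun j => (a.1 j : ℕ)))
    -- The minimum only provides the bound needed for `Fin (g + 1)`; on the antidiagonal it changes
    -- nothing.
    (fun f hf => ⟨fun j => ⟨min (f (some j)) g, by omega⟩, ?_⟩) ?_ ?_ ?_ ?_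
  · rw [Finset.mem_finsuppAntidiag, Finset.sum_insertNone] at hf
    calc ∑ j, min (f (some j)) g ≤ ∑ j, f (some j) :=
          Finset.sum_le_sum fun j _ => min_le_left _ _
      _ = ∑ j ∈ S, f (some j) := by
          symm
          refine Finset.sum_subset (Finset.subset_univ _) fun j _ hj => ?_
          by_contra h0
          exact hj (by simpa using hf.2 (Finsupp.mem_support_iff.2 h0))
      _ ≤ g := by omega
  · intro a ha
    rw [mem_monomialsIn] at ha
    have hs : ∑ j ∈ S, (a.1 j : ℕ) = ∑ j, (a.1 j : ℕ) := by
      refine Finset.sum_subset (Finset.subset_univ _) fun j _ hj => ?_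
      by_contra h0
      exact hj (ha (Monomial.mem_support.2 fun h1 => h0 (by simp [h1])))
    rw [Finset.mem_finsuppAntidiag, Finset.sum_insertNone]
    constructor
    · have := a.2
      simp only [Finsupp.equivFunOnFinite_symm_apply_apply, Option.elim]
      omega
    · intro o ho
      rcases o with _ | j
      · simp
      · simp only [Finsupp.mem_support_iff, Finsupp.equivFunOnFinite_symm_apply_apply,
          Option.elim] at ho
        simpa using ha (Monomial.mem_support.2 fun h1 => ho (by simp [h1]))
  · intro f hf
    rw [Finset.mem_finsuppAntidiag, Finset.sum_insertNone] at hf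
    rw [mem_monomialsIn]
    intro j hj
    rw [Monomial.mem_support] at hj
    have : f (some j) ≠ 0 := by
      intro h0
      apply hj
      ext
      simp [h0]
    simpa using hf.2 (Finsupp.mem_support_iff.2 this)
  · intro a ha
    apply Subtype.ext
    funext j
    ext
    have := (a.1 j).isLt
    simp only [Finsupp.equivFunOnFinite_symm_apply_apply, Option.elim]
    omega
  · intro f hf
    rw [Finset.mem_finsuppAntidiag, Finset.sum_insertNone] at hf
    have hS : ∀ j, f (some j) ≠ 0 → j ∈ S := fun j h0 => by
      simpa using hf.2 (Finsupp.mem_support_iff.2 h0)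
    have hle : ∀ j, f (some j) ≤ g := by
      intro j
      by_cases hj : j ∈ S
      · have := Finset.single_le_sum (f := fun j => f (some j)) (fun _ _ => Nat.zero_le _) hj
        omega
      · by_contra h0
        exact hj (hS j (by omega))
    have hsum : ∑ j ∈ S, f (some j) = ∑ j, f (some j) := by
      refine Finset.sum_subset (Finset.subset_univ _) fun j _ hj => ?_
      by_contra h0
      exact hj (hS j h0)
    ext o
    rcases o with _ | j
    · simp only [Finsupp.equivFunOnFinite_symm_apply_apply, Option.elim, min_eq_left (hle _)]
      omega
    · simp [min_eq_left (hle _)]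

theorem card_monomial (d g : ℕ) : Fintype.card (Monomial d g) = tau g d := by
  have h := card_monomialsIn g (Finset.univ : Finset (Fin d))
  rw [Finset.card_univ, Fintype.card_fin] at h
  rw [← h, ← Finset.card_univ]
  congr 1
  ext a
  simp [mem_monomialsIn]

theorem tau_mono (g : ℕ) {w w' : ℕ} (h : w ≤ w') : tau g w ≤ tau g w' :=
  Nat.choose_le_choose g (Nat.add_le_add_right h g)

theorem tau_pos (g w : ℕ) : 0 < tau g w := Nat.choose_pos (Nat.le_add_left g w)

theorem succ_le_tau {g : ℕ} (hg : 1 ≤ g) (w : ℕ) : w + 1 ≤ tau g w := by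
  obtain ⟨g, rfl⟩ := Nat.exists_eq_add_of_le' hg
  induction g with
  | zero => simp [tau]
  | succ g ih =>
    refine (ih (by omega)).trans ?_
    unfold tau
    rw [← Nat.choose_symm_add, ← Nat.choose_symm_add]
    exact Nat.choose_le_choose w (by omega)

/-! ### Runs of the pebble game -/

section Game

variable {V : Type} [DecidableEq V] {G : Digraph V} {M : ℕ}

theorem PebbleRun.trans {s t u : PebbleState V} {c c' : ℕ} (h : PebbleRun G M s t c)
    (h' : PebbleRun G M t u c') : PebbleRun G M s u (c + c') := by
  induction h' with
  | refl => exact h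
  | tail _ hm hc ih => rw [← add_assoc]; exact .tail ih hm hc

theorem PebbleRun.single {s t : PebbleState V} {k : ℕ} (hm : PebbleMove G s t k)
    (hc : t.red.card ≤ M) : PebbleRun G M s t k := by
  have := PebbleRun.tail (.refl s) hm hc
  rwa [zero_add] at this

theorem PebbleRun.card_red_le {s t : PebbleState V} {c : ℕ} (h : PebbleRun G M s t c)
    (hs : s.red.card ≤ M) : t.red.card ≤ M := by
  induction h with
  | refl => exact hs
  | tail _ _ hc _ => exact hc

/-- What a run can do with few transfers. `L` contains the values that are in fast memory at the
beginning or are loaded, `S` those that are saved, and `A` those that are available at some time. -/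
theorem PebbleRun.exists_available {s t : PebbleState V} {c : ℕ} (h : PebbleRun G M s t c) :
    ∃ (L S : Finset V) (A : Set V), L.card ≤ s.red.card + c ∧ S.card ≤ c ∧
      (∀ v ∈ A, v ∈ L ∨ (¬ IsSource G v ∧ parents G v ⊆ A)) ∧
      (∀ v ∈ t.red, v ∈ L ∨ (¬ IsSource G v ∧ t.agg v ⊆ A)) ∧
      (∀ v, ∀ u ∈ t.agg v, u ∉ s.agg v → u ∈ A) ∧
      (∀ v, ∀ u ∈ t.agg v, u ∉ s.agg v → v ∈ t.red ∨ v ∈ S) ∧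
      (∀ v, ∀ u ∈ t.agg v, u ∉ s.agg v → v ∈ t.blue → v ∈ S) := by
  induction h with
  | refl =>
    exact ⟨s.red, ∅, ∅, by simp, by simp, by simp, fun v hv => .inl hv,
      fun v u h h' => absurd h h', fun v u h h' => absurd h h', fun v u h h' => absurd h h'⟩
  | @tail t t' c k hrun hmove hcap ih =>
    obtain ⟨L, S, A, hL, hS, hA, hr, hn, ho, hb⟩ := ih
    cases hmove with
    | load v hv =>
      refine ⟨insert v L, S, A, (Finset.card_insert_le _ _).trans (by omega), by omega,
        fun x hx => (hA x hx).imp_left (Finset.mem_insert_of_mem ·), ?_, hn, ?_, hb⟩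
      · intro x hx
        rcases Finset.mem_insert.1 hx with rfl | hx
        · exact .inl (Finset.mem_insert_self _ _)
        · exact (hr x hx).imp_left (Finset.mem_insert_of_mem ·)
      · exact fun x u h h' => (ho x u h h').imp_left (Finset.mem_insert_of_mem ·)
    | save v hv =>
      refine ⟨L, insert v S, A, by omega, (Finset.card_insert_le _ _).trans (by omega), hA, hr,
        hn, fun x u h h' => (ho x u h h').imp_right (Finset.mem_insert_of_mem ·), ?_⟩
      intro x u h h' hx
      rcases hx with rfl | hx
      · exact Finset.mem_insert_self _ _
      · exact Finset.mem_insert_of_mem (hb x u h h' hx)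
    | compute u v huv hu hfull hnew hv =>
      -- The parent `u` is fully computed. If it is not in `L`, its aggregated set lies in `A`, and
      -- this set consists of all parents of `u`.
      have hA' : ∀ x ∈ insert u A, x ∈ L ∨ (¬ IsSource G x ∧ parents G x ⊆ insert u A) := by
        rintro x (rfl | hx)
        · refine (hr x hu).imp_right fun h => ⟨h.1, ?_⟩
          rw [← hfull]
          exact h.2.trans (Set.subset_insert _ _)
        · exact (hA x hx).imp_right fun h => ⟨h.1, h.2.trans (Set.subset_insert _ _)⟩
      refine ⟨L, S, insert u A, by omega, by omega, hA', ?_, ?_, ?_, ?_⟩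
      · intro x hx
        by_cases hxv : x = v
        · subst hxv
          simp only [Function.update_self]
          rcases hv with hv | ⟨_, hv⟩
          · exact (hr x hv).imp_right fun h => ⟨h.1, Set.insert_subset_insert h.2⟩
          · right
            rw [hv]
            exact ⟨fun h => h u huv, by simp⟩
        · rw [Finset.mem_insert, or_iff_right hxv] at hx
          simp only [Function.update_of_ne hxv]
          exact (hr x hx).imp_right fun h => ⟨h.1, h.2.trans (Set.subset_insert _ _)⟩
      · intro x y h h'
        by_cases hxv : x = v
        · subst hxv
          simp only [Function.update_self] at h
          rcases h with rfl | h
          · exact Set.mem_insert _ _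
          · exact Set.mem_insert_of_mem _ (hn _ _ h h')
        · simp only [Function.update_of_ne hxv] at h
          exact Set.mem_insert_of_mem _ (hn _ _ h h')
      · intro x y h h'
        by_cases hxv : x = v
        · subst hxv
          exact .inl (Finset.mem_insert_self _ _)
        · simp only [Function.update_of_ne hxv] at h
          exact (ho _ _ h h').imp_left (Finset.mem_insert_of_mem ·)
      · intro x y h h' hx
        have hxv : x ≠ v := fun h => hx.2 (by simp [h])
        simp only [Function.update_of_ne hxv] at h
        exact hb _ _ h h' hx.1
    -- The last clause of the invariant exists for this case: a value that leaves fast memory but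
    -- stays in slow memory, with something newly aggregated, must have been saved during the run.
    | delete v hv hv' =>
      refine ⟨L, S, A, by omega, by omega, hA, fun x hx => hr x (Finset.mem_of_mem_erase hx), hn,
        ?_, hb⟩
      intro x u h h'
      by_cases hxv : x = v
      · subst hxv
        exact .inr (hb _ _ h h' hv')
      · exact (ho x u h h').imp_left fun h => Finset.mem_erase.2 ⟨hxv, h⟩
    | clear v hv =>
      have key : ∀ x u, u ∈ Function.update t.agg v ∅ x → x ≠ v ∧ u ∈ t.agg x := by
        intro x u h
        have hxv : x ≠ v := by
          rintro rfl
          simp at h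
        exact ⟨hxv, by rwa [Function.update_of_ne hxv] at h⟩
      refine ⟨L, S, A, by omega, by omega, hA, ?_, fun x u h => hn x u (key x u h).2, ?_, ?_⟩
      · intro x hx
        have hxv := (Finset.mem_erase.1 hx).1
        simp only [Function.update_of_ne hxv]
        exact hr x (Finset.mem_of_mem_erase hx)
      · intro x u h h'
        exact (ho x u (key x u h).2 h').imp_left fun hx => Finset.mem_erase.2 ⟨(key x u h).1, hx⟩
      · intro x u h h' hx
        exact hb x u (key x u h).2 h' hx.1

/-- Cutting a run into segments of cost at most `M`: a potential that grows by at most `T` in each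
segment is at most `(c / M + 1) * T` at the end. -/
theorem PebbleRun.potential_le (hM : 1 ≤ M) (Φ : PebbleState V → ℕ) (T : ℕ)
    (hT : ∀ s t c, s.red.card ≤ M → PebbleRun G M s t c → c ≤ M → Φ t ≤ Φ s + T)
    {s t : PebbleState V} {c : ℕ} (h : PebbleRun G M s t c) (hs : s.red.card ≤ M) :
    Φ t * M ≤ Φ s * M + c * T + M * T := by
  -- `m` is the start of the current segment and `c₂` its cost so far. Moves cost at most 1, so a
  -- segment is closed at cost exactly `M`.
  suffices H : ∃ (m : PebbleState V) (c₁ c₂ : ℕ), m.red.card ≤ M ∧ PebbleRun G M m t c₂ ∧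
      c₂ ≤ M ∧ c₁ + c₂ = c ∧ Φ m * M ≤ Φ s * M + c₁ * T by
    obtain ⟨m, c₁, c₂, hm, hr, hc, rfl, hΦ⟩ := H
    have := Nat.mul_le_mul_right M (hT m t c₂ hm hr hc)
    nlinarith [Nat.zero_le (c₂ * T)]
  induction h with
  | refl => exact ⟨s, 0, 0, hs, .refl s, by omega, rfl, by omega⟩
  | @tail t t' c k hrun hmove hcap ih =>
    obtain ⟨m, c₁, c₂, hm, hr, hc, rfl, hΦ⟩ := ih
    by_cases hk : c₂ + k ≤ M
    · exact ⟨m, c₁, c₂ + k, hm, hr.tail hmove hcap, hk, by omega, hΦ⟩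
    · have hk1 : k ≤ 1 := by cases hmove <;> omega
      have hc2 : c₂ = M := by omega
      refine ⟨t, c₁ + c₂, k, hrun.card_red_le hs, .single hmove hcap, by omega, rfl, ?_⟩
      have := Nat.mul_le_mul_right M (hT m t c₂ hm hr hc)
      rw [hc2]
      nlinarith

/-- Every vertex of a finite set `O` of non-sources that is in slow memory had to be saved. -/
theorem PebbleRun.card_blue_le {t : PebbleState V} {c : ℕ} (h : PebbleRun G M (initialState G) t c)
    (O : Finset V) (hO : ∀ v ∈ O, ¬ IsSource G v) (ht : ∀ v ∈ O, v ∈ t.blue) : O.card ≤ c := by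
  suffices H : ∀ {s t : PebbleState V}, PebbleRun G M s t c →
      ∃ S : Finset V, S.card ≤ c ∧ ∀ v ∈ t.blue, v ∈ s.blue ∨ v ∈ S by
    obtain ⟨S, hS, hb⟩ := H h
    exact (Finset.card_le_card fun v hv => (hb v (ht v hv)).resolve_left (hO v hv)).trans hS
  clear h ht
  intro s t h
  induction h with
  | refl => exact ⟨∅, by simp, fun v => .inl⟩
  | @tail t t' c k hrun hmove hcap ih =>
    obtain ⟨S, hS, hb⟩ := ih
    cases hmove with
    | load v hv => exact ⟨S, by omega, hb⟩
    | save v hv =>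
      refine ⟨insert v S, (Finset.card_insert_le _ _).trans (by omega), ?_⟩
      rintro x (rfl | hx)
      · exact .inr (Finset.mem_insert_self _ _)
      · exact (hb x hx).imp_right (Finset.mem_insert_of_mem ·)
    | compute u v huv hu hfull hnew hv => exact ⟨S, by omega, fun x hx => hb x hx.1⟩
    | delete v hv hv' => exact ⟨S, by omega, hb⟩
    | clear v hv => exact ⟨S, by omega, fun x hx => hb x hx.1⟩

end Game

/-! ### Counting the products of a segment -/

section Counting

/-- Markov's inequality for fibres: few indices can have a large fibre in `L`. The factor `k` allows
"at least half" to be expressed without division. -/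
theorem card_mul_le_card_of_fibers {V ι : Type} [DecidableEq ι] (L : Finset V) (ρ : V → Option ι) (I : Finset ι)
    (m k : ℕ) (h : ∀ i ∈ I, m ≤ k * (L.filter fun x => ρ x = some i).card) :
    I.card * m ≤ k * L.card := by
  calc I.card * m = ∑ _i ∈ I, m := by rw [Finset.sum_const, smul_eq_mul]
    _ ≤ ∑ i ∈ I, k * (L.filter fun x => ρ x = some i).card := Finset.sum_le_sum h
    _ = k * ∑ i ∈ I.map Function.Embedding.some, (L.filter fun x => ρ x = i).card := by
        rw [Finset.sum_map, Finset.mul_sum]; rfl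
    _ ≤ k * L.card := by
        rw [Finset.sum_card_fiberwise_eq_card_filter]
        exact Nat.mul_le_mul_left _ (Finset.card_filter_le _ _)

-- A monomial is either stored itself, which happens at most `m` times, or is a monomial in the
-- stored variables, of which there are at most `min m d`.
open Classical in
theorem card_available_le {V : Type} {d g : ℕ} (Y : Finset V) (u : Monomial d g → V)
    (q : Fin d → V) (hu : Function.Injective u) (hq : Function.Injective q) (m : ℕ)
    (hY : Y.card ≤ m) :
    (Finset.univ.filter fun a : Monomial d g =>
      u a ∈ Y ∨ ∀ j, a.1 j ≠ 0 → q j ∈ Y).card ≤ m + tau g (min m d) := by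
  rw [Finset.filter_or]
  refine (Finset.card_union_le _ _).trans (Nat.add_le_add ?_ ?_)
  · refine le_trans ?_ hY
    exact Finset.card_le_card_of_injOn u (fun a ha => (Finset.mem_filter.1 ha).2) hu.injOn
  · have h : (Finset.univ.filter fun a : Monomial d g => ∀ j, a.1 j ≠ 0 → q j ∈ Y) =
        monomialsIn g (Finset.univ.filter fun j => q j ∈ Y) := by
      ext a
      simp [mem_monomialsIn, Finset.subset_iff, Monomial.mem_support]
    rw [h, card_monomialsIn]
    refine tau_mono g (le_min (le_trans ?_ hY) ?_)
    · exact Finset.card_le_card_of_injOn q (fun a ha => (Finset.mem_filter.1 ha).2) hq.injOn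
    · exact (Finset.card_le_univ _).trans (by simp)

variable {n d g : ℕ}

/-- The row of `Q` and `U₁` to which a node belongs. -/
def AttnNode.rowQ : AttnNode n d g → Option (Fin n)
  | .q i _ => some i
  | .u₁ i _ => some i
  | _ => none

/-- The row of `K` and `U₂` to which a node belongs. -/
def AttnNode.rowK : AttnNode n d g → Option (Fin n)
  | .k i _ => some i
  | .u₂ i _ => some i
  | _ => none

/-- The column of `V` to which a node belongs. -/
def AttnNode.colV : AttnNode n d g → Option (Fin d)
  | .v _ j => some j
  | _ => none

/-- The entry of `H` into which a scalar product is aggregated. -/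
def AttnNode.entryH : AttnNode n d g → Option (Monomial d g × Fin d)
  | .mulUV _ a j => some (a, j)
  | _ => none

open Classical in
/-- The monomials whose value in row `i` can be obtained from the values in `L`, for a matrix `u`
of monomials in the entries of `q`. -/
noncomputable def availableMonomials (L : Finset (AttnNode n d g))
    (u : Fin n → Monomial d g → AttnNode n d g) (q : Fin n → Fin d → AttnNode n d g) (i : Fin n) :
    Finset (Monomial d g) :=
  Finset.univ.filter fun a => u i a ∈ L ∨ ∀ j, a.1 j ≠ 0 → q i j ∈ L

open Classical in
theorem card_availableMonomials_le (L : Finset (AttnNode n d g))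
    (u : Fin n → Monomial d g → AttnNode n d g) (q : Fin n → Fin d → AttnNode n d g) (i : Fin n)
    (ρ : AttnNode n d g → Option (Fin n)) (hρu : ∀ a, ρ (u i a) = some i)
    (hρq : ∀ j, ρ (q i j) = some i)
    (hu : Function.Injective (u i)) (hq : Function.Injective (q i)) (m : ℕ)
    (hm : (L.filter fun x => ρ x = some i).card ≤ m) :
    (availableMonomials L u q i).card ≤ m + tau g (min m d) := by
  refine le_trans (Finset.card_le_card ?_) (card_available_le _ (u i) (q i) hu hq m hm)
  intro a ha
  simpa [availableMonomials, hρu, hρq] using ha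

open Classical in
/-- Products with a transferred entry of `H`. -/
theorem card_products_transferred_le (L : Finset (AttnNode n d g)) (O : Finset (Fin n × Fin d))
    (P : Finset (Fin n × Monomial d g × Fin d)) (w N : ℕ) (hL : L.card ≤ N) (hO : O.card ≤ N)
    (hPO : ∀ p ∈ P, (p.1, p.2.2) ∈ O) (hPL : ∀ p ∈ P, AttnNode.h p.2.1 p.2.2 ∈ L)
    (hPA : ∀ p ∈ P, p.2.1 ∈ availableMonomials L .u₁ .q p.1) :
    P.card * w ≤ N * N + w * ((w + tau g w) * N) := by
  -- The heavy rows. There are at most N/w of them, and a product in such a row is determined by the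
  -- row and by its entry of H, which lies in `L`.
  let I : Finset (Fin n) := Finset.univ.filter fun i =>
    w ≤ (L.filter fun x => x.rowQ = some i).card
  have hI : I.card * w ≤ N := by
    have := card_mul_le_card_of_fibers L AttnNode.rowQ I w 1
      fun i hi => by simpa [I] using hi
    omega
  rw [← Finset.card_filter_add_card_filter_not (s := P) fun p => p.1 ∈ I, add_mul]
  refine Nat.add_le_add ?_ ?_
  · have : (P.filter fun p => p.1 ∈ I).card ≤ (I ×ˢ L).card := by
      refine Finset.card_le_card_of_injOn (fun p => (p.1, AttnNode.h p.2.1 p.2.2)) ?_ ?_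
      · intro p hp
        rw [Finset.mem_coe, Finset.mem_filter] at hp
        simp [hp.2, hPL p hp.1]
      · rintro ⟨i, a, j⟩ _ ⟨i', a', j'⟩ _ h
        simpa using h
    rw [Finset.card_product] at this
    calc _ ≤ I.card * L.card * w := Nat.mul_le_mul_right _ this
      _ = (I.card * w) * L.card := by ring
      _ ≤ N * N := Nat.mul_le_mul hI hL
  -- Light rows: for a fixed output, a product is determined by its monomial, and fewer than `w`
  -- values of the row allow at most w + τ(w) monomials.
  · rw [mul_comm]
    refine Nat.mul_le_mul_left _ ?_
    refine le_trans (Finset.card_le_mul_card_image_of_maps_to (t := O)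
      (f := fun p => (p.1, p.2.2)) (fun p hp => hPO p (Finset.mem_filter.1 hp).1)
      (w + tau g w) ?_) (Nat.mul_le_mul_left _ hO)
    rintro ⟨i, j⟩ _
    by_cases hi : i ∈ I
    · rw [Finset.card_eq_zero.2]
      · exact Nat.zero_le _
      · ext p
        simp only [Finset.mem_filter, Finset.notMem_empty, iff_false, Prod.mk.injEq]
        rintro ⟨⟨_, h⟩, h', _⟩
        exact h (h' ▸ hi)
    · have hav : (availableMonomials L .u₁ .q i).card ≤ w + tau g w := by
        refine le_trans (card_availableMonomials_le L .u₁ .q i AttnNode.rowQ (fun _ => rfl)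
          (fun _ => rfl) (fun a b h => by simpa using h) (fun a b h => by simpa using h) w ?_) ?_
        · by_contra h
          exact hi (by simp only [I, Finset.mem_filter, Finset.mem_univ, true_and]; omega)
        · exact Nat.add_le_add_left (tau_mono g (min_le_left _ _)) _
      refine le_trans ?_ hav
      refine Finset.card_le_card_of_injOn (fun p => p.2.1) ?_ ?_
      · intro p hp
        simp only [Finset.coe_filter, Finset.mem_filter, Set.mem_ofPred_eq, Prod.mk.injEq] at hp
        have := hPA p hp.1.1
        rw [hp.2.1] at this
        exact this
      · rintro ⟨i, a, j⟩ h ⟨i', a', j'⟩ h' heq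
        simp only [Finset.coe_filter, Finset.mem_filter, Set.mem_ofPred_eq, Prod.mk.injEq] at h h'
        simp only at heq
        simp [h.2, h'.2, heq]

open Classical in
/-- Entries of `H` that are computed from scratch. -/
theorem card_scratch_le (hn : 1 ≤ n) (L : Finset (AttnNode n d g))
    (H : Finset (Monomial d g × Fin d)) (M : ℕ) (hL : L.card ≤ 2 * M)
    (hH : ∀ p ∈ H, ∀ i, AttnNode.mulUV i p.1 p.2 ∈ L ∨
      (AttnNode.v i p.2 ∈ L ∧ p.1 ∈ availableMonomials L .u₂ .k i)) :
    n * H.card ≤ 4 * M + 16 * M * (8 * M / n + tau g (min (8 * M / n) d)) := by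
  -- With this threshold at most n/4 rows contain more than `m` of the at most 2M values in `L`.
  set m := 8 * M / n with hm
  let H₁ := H.filter fun p => n ≤ 2 * (L.filter fun x => x.entryH = some p).card
  let J : Finset (Fin d) := Finset.univ.filter fun j =>
    n ≤ 2 * (L.filter fun x => x.colV = some j).card
  let A : Finset (Monomial d g) := Finset.univ.filter fun a =>
    n ≤ 2 * (Finset.univ.filter fun i => a ∈ availableMonomials L .u₂ .k i).card
  let I : Finset (Fin n) := Finset.univ.filter fun i =>
    m + 1 ≤ (L.filter fun x => x.rowK = some i).card
  have hH₁ : H₁.card * n ≤ 4 * M := by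
    have := card_mul_le_card_of_fibers L AttnNode.entryH H₁ n 2
      fun i hi => (Finset.mem_filter.1 hi).2
    omega
  have hJ : J.card * n ≤ 4 * M := by
    have := card_mul_le_card_of_fibers L AttnNode.colV J n 2
      fun i hi => (Finset.mem_filter.1 hi).2
    omega
  have hI : 4 * I.card ≤ n := by
    have h1 := card_mul_le_card_of_fibers L AttnNode.rowK I (m + 1) 1
      fun i hi => by simpa [I] using hi
    have h2 : 8 * M < n * (m + 1) := by
      rw [hm]; exact Nat.lt_mul_div_succ _ (by omega)
    by_contra h
    have : n * (m + 1) ≤ 4 * I.card * (m + 1) := Nat.mul_le_mul_right _ (by omega)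
    nlinarith
  -- A monomial in `A` is available in at least n/2 rows, hence in at least n/4 rows outside `I`.
  -- Each of those offers at most m + τ(min m d) monomials; count the pairs of monomial and row in
  -- two ways.
  have hA : A.card ≤ 4 * (m + tau g (min m d)) := by
    have h1 : A.card * n ≤ ∑ a ∈ A,
        4 * (Iᶜ.filter fun i => a ∈ availableMonomials L .u₂ .k i).card := by
      rw [← smul_eq_mul, ← Finset.sum_const]
      refine Finset.sum_le_sum fun a ha => ?_
      have h2 := (Finset.mem_filter.1 ha).2
      have h3 : (Finset.univ.filter fun i => a ∈ availableMonomials L .u₂ .k i) ⊆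
          I ∪ Iᶜ.filter fun i => a ∈ availableMonomials L .u₂ .k i := by
        intro i hi
        by_cases h : i ∈ I
        · exact Finset.mem_union_left _ h
        · refine Finset.mem_union_right _ (Finset.mem_filter.2 ⟨Finset.mem_compl.2 h, ?_⟩)
          exact (Finset.mem_filter.1 hi).2
      have h4 := (Finset.card_le_card h3).trans (Finset.card_union_le _ _)
      omega
    have hcomm := Finset.sum_card_bipartiteAbove_eq_sum_card_bipartiteBelow (s := A) (t := Iᶜ)
      fun a i => a ∈ availableMonomials L .u₂ .k i
    simp only [Finset.bipartiteAbove, Finset.bipartiteBelow] at hcomm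
    rw [← Finset.mul_sum, hcomm] at h1
    have h5 : ∑ i ∈ Iᶜ, (A.filter fun a => a ∈ availableMonomials L .u₂ .k i).card ≤
        n * (m + tau g (min m d)) := by
      refine (Finset.sum_le_card_nsmul _ _ (m + tau g (min m d)) fun i hi => ?_).trans ?_
      · refine (Finset.card_le_card fun a ha => (Finset.mem_filter.1 ha).2).trans
          (card_availableMonomials_le L .u₂ .k i AttnNode.rowK (fun _ => rfl)
          (fun _ => rfl) (fun a b h => by simpa using h) (fun a b h => by simpa using h) m ?_)
        simp only [I, Finset.mem_compl, Finset.mem_filter, Finset.mem_univ, true_and] at hi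
        omega
      · rw [smul_eq_mul]
        exact Nat.mul_le_mul_right _ ((Finset.card_le_univ _).trans (by simp))
    have h6 : A.card * n ≤ 4 * (m + tau g (min m d)) * n := by
      refine h1.trans ((Nat.mul_le_mul_left 4 h5).trans (le_of_eq (by ring)))
    exact Nat.le_of_mul_le_mul_right h6 hn
  -- An entry with fewer than half of its products in `L` must form the other products within the
  -- segment. This requires at least n/2 entries of its column of V, and its monomial in as many
  -- rows.
  have hsub : H ⊆ H₁ ∪ A ×ˢ J := by
    intro p hp
    by_cases h : p ∈ H₁
    · exact Finset.mem_union_left _ h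
    refine Finset.mem_union_right _ ?_
    have h1 : 2 * (Finset.univ.filter fun i => AttnNode.mulUV i p.1 p.2 ∈ L).card < n := by
      by_contra h2
      refine h (Finset.mem_filter.2 ⟨hp, (not_lt.1 h2).trans (Nat.mul_le_mul_left 2 ?_)⟩)
      refine Finset.card_le_card_of_injOn (fun i => AttnNode.mulUV i p.1 p.2) ?_ ?_
      · intro i hi
        exact Finset.mem_coe.2 (Finset.mem_filter.2 ⟨(Finset.mem_filter.1 hi).2, rfl⟩)
      · intro i _ i' _ h
        simpa using h
    have h2 : n ≤ (Finset.univ.filter fun i => AttnNode.mulUV i p.1 p.2 ∈ L).card +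
        (Finset.univ.filter fun i => AttnNode.v i p.2 ∈ L ∧
          p.1 ∈ availableMonomials L .u₂ .k i).card := by
      refine le_trans ?_ (Finset.card_union_le _ _)
      rw [← Finset.filter_or, Finset.filter_true_of_mem fun i _ => hH p hp i]
      simp
    rw [Finset.mem_product]
    simp only [A, J, Finset.mem_filter, Finset.mem_univ, true_and]
    constructor
    · have h3 : (Finset.univ.filter fun i => AttnNode.v i p.2 ∈ L ∧
          p.1 ∈ availableMonomials L .u₂ .k i).card ≤
          (Finset.univ.filter fun i => p.1 ∈ availableMonomials L .u₂ .k i).card :=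
        Finset.card_le_card (Finset.monotone_filter_right _ fun i _ h => h.2)
      omega
    · have h3 : (Finset.univ.filter fun i => AttnNode.v i p.2 ∈ L ∧
          p.1 ∈ availableMonomials L .u₂ .k i).card ≤
          (L.filter fun x => x.colV = some p.2).card := by
        refine Finset.card_le_card_of_injOn (fun i => AttnNode.v i p.2) ?_ ?_
        · intro i hi
          exact Finset.mem_coe.2 (Finset.mem_filter.2 ⟨(Finset.mem_filter.1 hi).2.1, rfl⟩)
        · intro i _ i' _ h
          simpa using h
      omega
  calc n * H.card ≤ n * (H₁.card + A.card * J.card) := by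
        refine Nat.mul_le_mul_left _ ((Finset.card_le_card hsub).trans ?_)
        rw [← Finset.card_product]
        exact Finset.card_union_le _ _
    _ = H₁.card * n + J.card * n * A.card := by ring
    _ ≤ 4 * M + 4 * M * (4 * (m + tau g (min m d))) :=
        Nat.add_le_add hH₁ (Nat.mul_le_mul hJ hA)
    _ = _ := by ring

end Counting

/-! ### The lower bound: progress per segment, and the resulting cost -/

section LowerBound

variable {n d g : ℕ}

theorem isSource_q (i : Fin n) (j : Fin d) :
    IsSource (attentionDAG n d g) (.q i j) := by
  intro u h
  cases h

theorem isSource_k (i : Fin n) (j : Fin d) :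
    IsSource (attentionDAG n d g) (.k i j) := by
  intro u h
  cases h

theorem isSource_v (i : Fin n) (j : Fin d) :
    IsSource (attentionDAG n d g) (.v i j) := by
  intro u h
  cases h

theorem isSink_out (i : Fin n) (j : Fin d) :
    IsSink (attentionDAG n d g) (.out i j) := by
  intro u h
  cases h

theorem parents_out (i : Fin n) (j : Fin d) :
    parents (attentionDAG n d g) (.out i j) = Set.range fun a => .mulUH i a j := by
  ext u
  constructor
  · rintro ⟨⟩
    exact ⟨_, rfl⟩
  · rintro ⟨a, rfl⟩
    exact .mul_out i a j

open Classical in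
/-- The number of scalar products that are aggregated into the current values of the outputs. -/
noncomputable def outProgress (s : PebbleState (AttnNode n d g)) : ℕ :=
  (Finset.univ.filter fun p : Fin n × Monomial d g × Fin d =>
    AttnNode.mulUH p.1 p.2.1 p.2.2 ∈ s.agg (.out p.1 p.2.2)).card

/-- The only term that is not immediate is τ(min m d)·w with m = ⌊8M/n⌋. If m ≤ w it is at most
τ(w)·w, which is O(M); if m ≥ w it is at most τ(d)·m ≤ n·m ≤ 8M. The second case is where τ(d) ≤ n
is essential. -/
theorem segment_bound_arith {n d g M w x : ℕ} (hn : tau g d ≤ n) (hw : 1 ≤ w) (hwd : w ≤ d)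
    (hwt : w ≤ tau g w) (hdn : d ≤ tau g d) (hM : 4 * (w * tau g w) ≤ M)
    (hx : x * w ≤ 2 * M * w + (2 * M * (2 * M) + w * ((w + tau g w) * (2 * M))) +
      (4 * M + 16 * M * (8 * M / n + tau g (min (8 * M / n) d))) * w) :
    x * w ≤ 400 * M ^ 2 := by
  have h1 : w * w ≤ w * tau g w := Nat.mul_le_mul_left _ hwt
  have h2 : w ≤ w * tau g w := Nat.le_mul_of_pos_right _ (tau_pos g w)
  set m := 8 * M / n with hm
  have hmn : m * n ≤ 8 * M := Nat.div_mul_le_self _ _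
  have h3 : m * w ≤ 8 * M := (Nat.mul_le_mul_left m (by omega)).trans hmn
  have h4 : tau g (min m d) * w ≤ 8 * M := by
    rcases le_total m w with h | h
    · have : tau g (min m d) * w ≤ tau g w * w :=
        Nat.mul_le_mul_right _ (tau_mono g ((min_le_left _ _).trans h))
      nlinarith
    · have : tau g (min m d) * w ≤ n * m :=
        Nat.mul_le_mul ((tau_mono g (min_le_right _ _)).trans hn) h
      nlinarith
  have e1 : M * (m * w) ≤ M * (8 * M) := Nat.mul_le_mul_left _ h3
  have e2 : M * (tau g (min m d) * w) ≤ M * (8 * M) := Nat.mul_le_mul_left _ h4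
  have e3 : M * (4 * w) ≤ M * M := Nat.mul_le_mul_left _ (by omega)
  have e4 : M * (4 * (w * w)) ≤ M * M := Nat.mul_le_mul_left _ (by omega)
  have e5 : M * (4 * (w * tau g w)) ≤ M * M := Nat.mul_le_mul_left _ hM
  nlinarith

-- New products fall into three classes: the product itself is in `L`; otherwise its entry of H is
-- in `L`; otherwise that entry is computed within the segment. In the last two classes the entry of
-- U₁ is available, so it is in `L` or has all its variables in `L`.
open Classical in
theorem outProgress_le_add {M w : ℕ} (hg : 1 ≤ g) (hn : tau g d ≤ n) (hw : 1 ≤ w) (hwd : w ≤ d)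
    (hM : 4 * (w * tau g w) ≤ M) {s t : PebbleState (AttnNode n d g)} {c : ℕ}
    (hs : s.red.card ≤ M) (h : PebbleRun (attentionDAG n d g) M s t c) (hc : c ≤ M) :
    outProgress t ≤ outProgress s + 400 * M ^ 2 / w := by
  obtain ⟨L, S, A, hL, hS, hA, -, hagg, hout, -⟩ := h.exists_available
  have ht := h.card_red_le hs
  let P : Finset (Fin n × Monomial d g × Fin d) := Finset.univ.filter fun p =>
    AttnNode.mulUH p.1 p.2.1 p.2.2 ∈ t.agg (.out p.1 p.2.2) ∧
      AttnNode.mulUH p.1 p.2.1 p.2.2 ∉ s.agg (.out p.1 p.2.2)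
  have hP : outProgress t ≤ outProgress s + P.card := by
    refine (Finset.card_le_card fun p hp => ?_).trans (Finset.card_union_le _ _)
    have hp := (Finset.mem_filter.1 hp).2
    simp only [P, Finset.mem_union, Finset.mem_filter, Finset.mem_univ, true_and, hp]
    exact Classical.em _
  refine hP.trans (Nat.add_le_add_left ((Nat.le_div_iff_mul_le hw).2 ?_) _)
  have hPmem : ∀ p ∈ P, AttnNode.mulUH p.1 p.2.1 p.2.2 ∈ t.agg (.out p.1 p.2.2) ∧
      AttnNode.mulUH p.1 p.2.1 p.2.2 ∉ s.agg (.out p.1 p.2.2) :=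
    fun p hp => (Finset.mem_filter.1 hp).2
  let O : Finset (Fin n × Fin d) := Finset.univ.filter fun p => AttnNode.out p.1 p.2 ∈ t.red ∪ S
  have hO : O.card ≤ 2 * M := by
    refine le_trans (Finset.card_le_card_of_injOn (fun p => AttnNode.out p.1 p.2)
      (fun p hp => (Finset.mem_filter.1 hp).2) ?_) ((Finset.card_union_le t.red S).trans (by omega))
    rintro ⟨i, j⟩ _ ⟨i', j'⟩ _ h
    simpa using h
  have hPO : ∀ p ∈ P, (p.1, p.2.2) ∈ O := by
    intro p hp
    have := hout _ _ (hPmem p hp).1 (hPmem p hp).2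
    simpa [O] using this
  have hsrc : ∀ v ∈ A, IsSource (attentionDAG n d g) v → v ∈ L :=
    fun v hv h => (hA v hv).resolve_right fun h' => h'.1 h
  have hU₁ : ∀ i a, AttnNode.u₁ i a ∈ A → a ∈ availableMonomials L .u₁ .q i := by
    intro i a h
    refine Finset.mem_filter.2 ⟨Finset.mem_univ _, (hA _ h).imp_right fun h j hj => ?_⟩
    exact hsrc _ (h.2 (AttnEdge.q_u₁ i j a hj)) (isSource_q i j)
  have hU₂ : ∀ i a, AttnNode.u₂ i a ∈ A → a ∈ availableMonomials L .u₂ .k i := by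
    intro i a h
    refine Finset.mem_filter.2 ⟨Finset.mem_univ _, (hA _ h).imp_right fun h j hj => ?_⟩
    exact hsrc _ (h.2 (AttnEdge.k_u₂ i j a hj)) (isSource_k i j)
  let P₀ := P.filter fun p => AttnNode.mulUH p.1 p.2.1 p.2.2 ∈ L
  let P₁ := P.filter fun p => AttnNode.mulUH p.1 p.2.1 p.2.2 ∉ L ∧ AttnNode.h p.2.1 p.2.2 ∈ L
  let P₂ := P.filter fun p => AttnNode.mulUH p.1 p.2.1 p.2.2 ∉ L ∧ AttnNode.h p.2.1 p.2.2 ∉ L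
  have hprod : ∀ p ∈ P, AttnNode.mulUH p.1 p.2.1 p.2.2 ∉ L →
      AttnNode.u₁ p.1 p.2.1 ∈ A ∧ AttnNode.h p.2.1 p.2.2 ∈ A := by
    intro p hp hpL
    have := ((hA _ (hagg _ _ (hPmem p hp).1 (hPmem p hp).2)).resolve_left hpL).2
    exact ⟨this (AttnEdge.u₁_mul _ _ _), this (AttnEdge.h_mul _ _ _)⟩
  have hP₀ : P₀.card ≤ 2 * M := by
    refine le_trans (Finset.card_le_card_of_injOn (fun p => AttnNode.mulUH p.1 p.2.1 p.2.2)
      (fun p hp => (Finset.mem_filter.1 hp).2) ?_) (hL.trans (by omega))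
    rintro ⟨i, a, j⟩ _ ⟨i', a', j'⟩ _ h
    simpa using h
  have hP₁ := card_products_transferred_le L O P₁ w (2 * M) (by omega) hO
    (fun p hp => hPO p (Finset.mem_filter.1 hp).1) (fun p hp => (Finset.mem_filter.1 hp).2.2)
    fun p hp => hU₁ _ _ (hprod p (Finset.mem_filter.1 hp).1 (Finset.mem_filter.1 hp).2.1).1
  -- An entry of H serves at most one product per row of U₁; this is the factor `n` on the left of
  -- `card_scratch_le`.
  have hP₂ : P₂.card ≤ n * (P₂.image Prod.snd).card := by
    refine Finset.card_le_mul_card_image _ _ fun b _ => ?_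
    refine le_trans (Finset.card_le_card_of_injOn (t := Finset.univ) Prod.fst
      (fun p _ => Finset.mem_univ _) ?_) (by simp)
    intro p hp q hq h
    have hp := (Finset.mem_filter.1 hp).2
    have hq := (Finset.mem_filter.1 hq).2
    exact Prod.ext h (hp.trans hq.symm)
  have hP₂' := card_scratch_le (by have := tau_pos g d; omega) L (P₂.image Prod.snd) M (by omega)
    (by
      intro p hp i
      obtain ⟨q, hq, rfl⟩ := Finset.mem_image.1 hp
      obtain ⟨hq, hq1, hq2⟩ := Finset.mem_filter.1 hq
      have hH := ((hA _ (hprod q hq hq1).2).resolve_left hq2).2 (AttnEdge.mul_h i _ _)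
      refine (hA _ hH).imp_right fun h => ?_
      exact ⟨hsrc _ (h.2 (AttnEdge.v_mul i _ _)) (isSource_v _ _),
        hU₂ _ _ (h.2 (AttnEdge.u₂_mul i _ _))⟩)
  have hsplit : P.card ≤ P₀.card + P₁.card + P₂.card := by
    refine (Finset.card_le_card (t := P₀ ∪ P₁ ∪ P₂) fun p hp => ?_).trans
      ((Finset.card_union_le _ _).trans (Nat.add_le_add_right (Finset.card_union_le _ _) _))
    simp only [P₀, P₁, P₂, Finset.mem_union, Finset.mem_filter, hp, true_and]
    tauto
  have h1 := succ_le_tau hg w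
  have h2 := succ_le_tau hg d
  refine segment_bound_arith hn hw hwd (by omega) (by omega) hM ?_
  refine (Nat.mul_le_mul_right w hsplit).trans ?_
  rw [add_mul, add_mul]
  exact Nat.add_le_add (Nat.add_le_add (Nat.mul_le_mul_right _ hP₀) hP₁)
    (Nat.mul_le_mul_right _ (hP₂.trans hP₂'))

/-- If r·w ≤ M, saving the n·d outputs is already expensive enough. Otherwise the potential argument
applies. -/
theorem le_cost_of_mem_ioCosts {M w c : ℕ} (hg : 1 ≤ g) (hn : tau g d ≤ n) (hw : 1 ≤ w)
    (hwd : w ≤ d) (hM : 4 * (w * tau g w) ≤ M) (hMd : 2000 * M ≤ d * tau g d)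
    (hc : c ∈ ioCosts (attentionDAG n d g) M) :
    n * tau g d * d * w ≤ 500 * (M * c) := by
  classical
  obtain ⟨t, hrun, hfin⟩ := hc
  rcases le_total (tau g d * w) M with h | h
  · have hnd : n * d ≤ c := by
      let O : Finset (AttnNode n d g) :=
        (Finset.univ : Finset (Fin n × Fin d)).image fun p => AttnNode.out p.1 p.2
      have hO : O.card = n * d := by
        rw [Finset.card_image_of_injective]
        · simp
        · rintro ⟨i, j⟩ ⟨i', j'⟩ h
          simpa using h
      rw [← hO]
      refine hrun.card_blue_le O ?_ ?_
      · intro v hv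
        obtain ⟨p, -, rfl⟩ := Finset.mem_image.1 hv
        exact fun h => h _ (AttnEdge.mul_out p.1 ⟨0, by simp⟩ p.2)
      · intro v hv
        obtain ⟨p, -, rfl⟩ := Finset.mem_image.1 hv
        exact (hfin _ (isSink_out _ _)).1
    calc n * tau g d * d * w = n * d * (tau g d * w) := by ring
      _ ≤ c * M := Nat.mul_le_mul hnd h
      _ ≤ 500 * (M * c) := by nlinarith [Nat.zero_le (M * c)]
  · have hM1 : 1 ≤ M := by
      have := Nat.mul_pos hw (tau_pos g w)
      omega
    have hpot := hrun.potential_le hM1 outProgress (400 * M ^ 2 / w)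
      (fun s t c hs hr hc => outProgress_le_add hg hn hw hwd hM hs hr hc) (by simp [initialState])
    have h0 : outProgress (initialState (attentionDAG n d g)) = 0 := by
      simp [outProgress, initialState]
    have h1 : outProgress t = n * (tau g d * d) := by
      rw [outProgress, Finset.filter_true_of_mem]
      · rw [Finset.card_univ, Fintype.card_prod, Fintype.card_prod, card_monomial]
        simp
      · rintro ⟨i, a, j⟩ _
        rw [(hfin _ (isSink_out _ _)).2, parents_out]
        exact ⟨a, rfl⟩
    rw [h0, h1, zero_mul, zero_add] at hpot
    have hT : 400 * M ^ 2 / w * w ≤ 400 * M ^ 2 := Nat.div_mul_le_self _ _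
    set T := 400 * M ^ 2 / w
    have h2 : n * (tau g d * d) * w * M ≤ (400 * (M * c) + 400 * M ^ 2) * M := by
      calc n * (tau g d * d) * w * M = n * (tau g d * d) * M * w := by ring
        _ ≤ (c * T + M * T) * w := Nat.mul_le_mul_right _ hpot
        _ = (c + M) * (T * w) := by ring
        _ ≤ (c + M) * (400 * M ^ 2) := Nat.mul_le_mul_left _ hT
        _ = _ := by ring
    have h3 := Nat.le_of_mul_le_mul_right h2 hM1
    -- The term 400·M² stems from the last segment, which need not be complete. It is at most a
    -- fifth of n·r·d·w, which turns the constant 400 into 500.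
    have h4 : 2000 * M * M ≤ d * n * (tau g d * w) :=
      Nat.mul_le_mul (hMd.trans (Nat.mul_le_mul_left _ hn)) h
    nlinarith

end LowerBound

/-! ### Composite moves -/

section Strategy

variable {V : Type} [DecidableEq V] {G : Digraph V} {M : ℕ}

theorem PebbleRun.load_all {R : Finset V} {B : Set V} {f : V → Set V} (X : Finset V)
    (hX : ∀ x ∈ X, x ∈ B) (hc : (R ∪ X).card ≤ M) :
    PebbleRun G M ⟨R, B, f⟩ ⟨R ∪ X, B, f⟩ X.card := by
  induction X using Finset.induction_on with
  | empty => simpa using PebbleRun.refl _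
  | insert x X hx ih =>
    rw [Finset.card_insert_of_notMem hx]
    rw [Finset.union_insert] at hc ⊢
    refine .tail (ih (fun y hy => hX y (Finset.mem_insert_of_mem hy))
      ((Finset.card_le_card (Finset.subset_insert _ _)).trans hc)) ?_ hc
    exact PebbleMove.load ⟨R ∪ X, B, f⟩ x (hX x (Finset.mem_insert_self _ _))

theorem PebbleRun.save_all {R : Finset V} {B : Set V} {f : V → Set V} (X : Finset V)
    (hX : X ⊆ R) (hc : R.card ≤ M) :
    PebbleRun G M ⟨R, B, f⟩ ⟨R, B ∪ X, f⟩ X.card := by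
  induction X using Finset.induction_on with
  | empty => simpa using PebbleRun.refl _
  | insert x X hx ih =>
    rw [Finset.card_insert_of_notMem hx, Finset.coe_insert, Set.union_insert]
    refine .tail (ih fun y hy => hX (Finset.mem_insert_of_mem hy)) ?_ hc
    exact PebbleMove.save ⟨R, B ∪ X, f⟩ x (hX (Finset.mem_insert_self _ _))

theorem PebbleRun.delete_all {R : Finset V} {B : Set V} {f : V → Set V} (X : Finset V)
    (hX : X ⊆ R) (hB : ∀ x ∈ X, x ∈ B) (hc : R.card ≤ M) :
    PebbleRun G M ⟨R, B, f⟩ ⟨R \ X, B, f⟩ 0 := by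
  induction X using Finset.induction_on with
  | empty => simpa using PebbleRun.refl _
  | insert x X hx ih =>
    have h1 := ih (fun y hy => hX (Finset.mem_insert_of_mem hy))
      fun y hy => hB y (Finset.mem_insert_of_mem hy)
    have h2 : R \ insert x X = (R \ X).erase x := by
      ext y
      simp only [Finset.mem_sdiff, Finset.mem_insert, Finset.mem_erase]
      tauto
    rw [h2]
    refine .tail h1 (PebbleMove.delete ⟨R \ X, B, f⟩ x ?_ (hB x (Finset.mem_insert_self _ _))) ?_
    · exact Finset.mem_sdiff.2 ⟨hX (Finset.mem_insert_self _ _), hx⟩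
    · rw [← h2]
      exact (Finset.card_le_card Finset.sdiff_subset).trans hc

theorem PebbleRun.clear_all {R : Finset V} {B : Set V} {f : V → Set V} (X : Finset V)
    (hX : ∀ x ∈ X, ¬ IsSource G x) (hc : R.card ≤ M) :
    PebbleRun G M ⟨R, B, f⟩ ⟨R \ X, B \ X, fun v => if v ∈ X then ∅ else f v⟩ 0 := by
  induction X using Finset.induction_on with
  | empty => simpa using PebbleRun.refl _
  | insert x X hx ih =>
    have h1 := ih fun y hy => hX y (Finset.mem_insert_of_mem hy)
    have h2 := PebbleMove.clear (G := G) ⟨R \ X, B \ X, fun v => if v ∈ X then ∅ else f v⟩ x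
      (hX x (Finset.mem_insert_self _ _))
    have h3 : R \ insert x X = (R \ X).erase x := by
      ext y
      simp only [Finset.mem_sdiff, Finset.mem_insert, Finset.mem_erase]
      tauto
    have h4 : B \ (insert x X : Finset V) = (B \ X) \ {x} := by
      ext y
      simp only [Set.mem_sdiff, Finset.coe_insert, Set.mem_insert_iff, Set.mem_singleton_iff]
      tauto
    have h5 : (fun v => if v ∈ insert x X then ∅ else f v) =
        Function.update (fun v => if v ∈ X then ∅ else f v) x ∅ := by
      funext v
      by_cases hv : v = x
      · subst hv; simp
      · simp [hv]
    rw [h3, h4, h5]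
    refine .tail h1 h2 ?_
    exact (Finset.card_le_card ((Finset.erase_subset _ _).trans Finset.sdiff_subset)).trans hc

/-- Aggregating all values from `X`, which lie in fast memory, into a fresh vertex `u`. -/
theorem PebbleRun.aggregate_all {R : Finset V} {B : Set V} {f : V → Set V} (u : V)
    {X : Finset V} (hne : X.Nonempty) (hXR : X ⊆ R) (hX : ∀ x ∈ X, G.Adj x u ∧ f x = parents G x)
    (hu : u ∉ R) (huB : u ∉ B) (hfu : f u = ∅) (hc : R.card + 1 ≤ M) :
    PebbleRun G M ⟨R, B, f⟩ ⟨insert u R, B, Function.update f u X⟩ 0 := by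
  induction hne using Finset.Nonempty.cons_induction with
  | singleton x =>
    have hx := hX x (Finset.mem_singleton_self x)
    have hm := PebbleMove.compute (G := G) ⟨R, B, f⟩ x u hx.1 (hXR (Finset.mem_singleton_self x))
      hx.2 (by simp [hfu]) (.inr ⟨huB, hfu⟩)
    simp only [hfu, Set.sdiff_singleton_eq_self huB] at hm
    simpa using PebbleRun.single hm ((Finset.card_insert_le _ _).trans hc)
  | cons x X hx hne ih =>
    rw [Finset.cons_eq_insert] at hXR hX ⊢
    have h1 := ih ((Finset.subset_insert _ _).trans hXR)
      fun y hy => hX y (Finset.mem_insert_of_mem hy)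
    have hx' := hX x (Finset.mem_insert_self _ _)
    have hxR : x ∈ R := hXR (Finset.mem_insert_self _ _)
    have hxu : x ≠ u := fun h => hu (h ▸ hxR)
    have hm := PebbleMove.compute (G := G) ⟨insert u R, B, Function.update f u X⟩ x u hx'.1
      (Finset.mem_insert_of_mem hxR) (by simp [FullyComputed, hxu, hx'.2]) (by simpa using hx)
      (.inl (Finset.mem_insert_self _ _))
    simp only [Set.sdiff_singleton_eq_self huB, Function.update_self, Function.update_idem,
      Finset.insert_idem] at hm
    rw [Finset.coe_insert]
    exact .tail h1 hm ((Finset.card_insert_le _ _).trans hc)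

/-- Computing a vertex `p` from its two parents, aggregating it into `t`, and discarding it. -/
theorem PebbleRun.multiply_add {R : Finset V} {B : Set V} {f : V → Set V} {p t x y : V}
    (hp : parents G p = {x, y}) (hxy : x ≠ y) (hx : x ∈ R) (hfx : f x = parents G x)
    (hy : y ∈ R) (hfy : f y = parents G y) (hpR : p ∉ R) (hpB : p ∉ B) (hfp : f p = ∅)
    (hpt : G.Adj p t) (hne : t ≠ p) (hnew : p ∉ f t) (ht : t ∈ R ∨ (t ∉ B ∧ f t = ∅))
    (hc : (insert t R).card + 1 ≤ M) :
    PebbleRun G M ⟨R, B, f⟩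
      ⟨insert t R, B \ {t}, Function.update f t (insert p (f t))⟩ 0 := by
  have hadj : ∀ u ∈ ({x, y} : Finset V), G.Adj u p ∧ f u = parents G u := by
    intro u hu
    have h : u ∈ parents G p := by simpa [hp] using hu
    refine ⟨h, ?_⟩
    rcases Finset.mem_insert.1 hu with rfl | hu
    · exact hfx
    · rw [Finset.mem_singleton.1 hu, hfy]
  have hRt : R.card ≤ (insert t R).card := Finset.card_le_card (Finset.subset_insert _ _)
  have h1 := PebbleRun.aggregate_all (G := G) (M := M) (B := B) p (X := {x, y}) ⟨x, by simp⟩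
    (by simp [Finset.insert_subset_iff, hx, hy]) hadj hpR hpB hfp (by omega)
  have hpx : ¬ IsSource G p := fun h => h x (hadj x (by simp)).1
  have hm1 := PebbleMove.compute (G := G) ⟨insert p R, B, Function.update f p ({x, y} : Finset V)⟩
    p t hpt (Finset.mem_insert_self _ _) (by simp [FullyComputed, hp]) (by simpa [hne] using hnew)
    (by simpa [hne] using ht)
  have hm2 := PebbleMove.clear (G := G) ⟨insert t (insert p R), B \ {t},
    Function.update (Function.update f p ({x, y} : Finset V)) t (insert p (f t))⟩ p hpx
  simp only [Function.update_of_ne hne] at hm1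
  have h2 := PebbleRun.tail (h1.tail hm1 ?_) hm2 ?_
  · convert h2 using 2
    · ext v
      simp only [Finset.mem_insert, Finset.mem_erase]
      constructor
      · rintro (rfl | h)
        · exact ⟨hne, .inl rfl⟩
        · exact ⟨fun e => hpR (e ▸ h), .inr (.inr h)⟩
      · tauto
    · exact (Set.sdiff_singleton_eq_self fun h => hpB h.1).symm
    · funext v
      by_cases hv : v = p
      · subst hv
        simp [hfp, hne.symm]
      · by_cases hv' : v = t
        · subst hv'; simp [hv]
        · simp [hv, hv']
  · rw [Finset.insert_comm]
    exact (Finset.card_insert_le _ _).trans hc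
  · refine (Finset.card_le_card (Finset.erase_subset _ _)).trans ?_
    rw [Finset.insert_comm]
    exact (Finset.card_insert_le _ _).trans hc

/-- As `PebbleRun.multiply_add`, where the parent `x` is computed from values in fast memory and
discarded afterwards. -/
theorem PebbleRun.compute_multiply_add {R : Finset V} {B : Set V} {f : V → Set V} {p t x y : V}
    {X : Finset V} (hp : parents G p = {x, y}) (hxR : x ∉ R) (hxB : x ∉ B) (hfx : f x = ∅)
    (hX : parents G x = X) (hne : X.Nonempty) (hXR : X ⊆ R) (hXf : ∀ z ∈ X, f z = parents G z)
    (hy : y ∈ R) (hfy : f y = parents G y) (hpR : p ∉ R) (hpB : p ∉ B) (hfp : f p = ∅)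
    (hpt : G.Adj p t) (htp : t ≠ p) (htx : t ≠ x) (hpx : p ≠ x) (hnew : p ∉ f t)
    (ht : t ∈ R ∨ (t ∉ B ∧ f t = ∅))
    (hc : (insert t R).card + 2 ≤ M) :
    PebbleRun G M ⟨R, B, f⟩
      ⟨insert t R, B \ {t}, Function.update f t (insert p (f t))⟩ 0 := by
  have hRt : R.card ≤ (insert t R).card := Finset.card_le_card (Finset.subset_insert _ _)
  have hadj : ∀ z ∈ X, G.Adj z x ∧ f z = parents G z := fun z hz =>
    ⟨show z ∈ parents G x by rw [hX]; exact hz, hXf z hz⟩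
  have h1 := PebbleRun.aggregate_all (G := G) (M := M) (B := B) x hne hXR hadj hxR hxB hfx
    (by omega)
  have hyx : y ≠ x := fun h => hxR (h ▸ hy)
  have hcard : (insert t (insert x R)).card + 1 ≤ M := by
    rw [Finset.insert_comm]
    have := Finset.card_insert_le x (insert t R)
    omega
  have h2 := PebbleRun.multiply_add (G := G) (M := M) (R := insert x R) (B := B)
    (f := Function.update f x X) (t := t) hp hyx.symm (Finset.mem_insert_self _ _) (by simp [hX])
    (Finset.mem_insert_of_mem hy) (by simp [hyx, hfy]) (by simp [hpx, hpR]) hpB (by simp [hpx, hfp])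
    hpt htp (by simpa [htx] using hnew) (by simpa [htx] using ht) hcard
  obtain ⟨z, hz⟩ := hne
  have h3 := PebbleRun.tail (h1.trans h2) (PebbleMove.clear _ x fun h => h z (hadj z hz).1) ?_
  · convert h3 using 2
    · ext v
      simp only [Finset.mem_insert, Finset.mem_erase]
      constructor
      · rintro (rfl | h)
        · exact ⟨htx, .inl rfl⟩
        · exact ⟨fun e => hxR (e ▸ h), .inr (.inr h)⟩
      · tauto
    · exact (Set.sdiff_singleton_eq_self fun h => hxB h.1).symm
    · funext v
      by_cases hv : v = x
      · subst hv
        simp [hfx, htx.symm]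
      · by_cases hv' : v = t
        · subst hv'; simp [hv]
        · simp [hv, hv']
  · exact (Finset.card_le_card (Finset.erase_subset _ _)).trans ((Nat.le_succ _).trans hcard)

/-- The state in which exactly the vertices in `D` are aggregated into their children. -/
def progressState (G : Digraph V) (R : Finset V) (B D : Set V) : PebbleState V :=
  ⟨R, B, fun v => {u | u ∈ D ∧ G.Adj u v}⟩

/-- Computing the products in `P` and aggregating each of them into its only child. A product has
a parent in `W`, and the other one is in `W` or has all its parents in `W`. -/
theorem PebbleRun.multiply_add_all {R : Finset V} {B D : Set V} (W : Finset V) (tgt : V → V)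
    (P : Finset V) (hWR : W ⊆ R) (hWD : ∀ x ∈ W, ∀ u, G.Adj u x → u ∈ D)
    (hPR : ∀ p ∈ P, p ∉ R ∧ p ∉ B ∧ p ∉ D)
    (htgt : ∀ p ∈ P, ∀ v, G.Adj p v ↔ v = tgt p)
    (hPp : ∀ p ∈ P, ∀ u, u ∈ D ∨ u ∈ P → ¬ G.Adj u p)
    (hPt : ∀ p ∈ P, tgt p ∈ R ∨ (tgt p ∉ B ∧ ∀ u ∈ D, ¬ G.Adj u (tgt p)))
    (hop : ∀ p ∈ P, ∃ x y, parents G p = {x, y} ∧ x ≠ y ∧ y ∈ W ∧ (x ∈ W ∨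
      (x ∉ R ∧ x ∉ B ∧ (∀ u, u ∈ D ∨ u ∈ P → ¬ G.Adj u x) ∧
        ∃ X : Finset V, parents G x = X ∧ X.Nonempty ∧ X ⊆ W)))
    (hc : (R ∪ P.image tgt).card + 2 ≤ M) :
    PebbleRun G M (progressState G R B D)
      (progressState G (R ∪ P.image tgt) (B \ P.image tgt) (D ∪ P)) 0 := by
  induction P using Finset.induction_on with
  | empty => simpa using PebbleRun.refl _
  | insert p P hpP ih =>
    have hsub : R ∪ P.image tgt ⊆ R ∪ (insert p P).image tgt :=
      Finset.union_subset_union_right (Finset.image_subset_image (Finset.subset_insert _ _))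
    have hin : ∀ q ∈ P, q ∈ insert p P := fun q hq => Finset.mem_insert_of_mem hq
    have hself : p ∈ insert p P := Finset.mem_insert_self _ _
    have h1 := ih (fun q hq => hPR q (hin q hq)) (fun q hq => htgt q (hin q hq))
      (fun q hq u hu => hPp q (hin q hq) u (hu.imp_right (hin u)))
      (fun q hq => hPt q (hin q hq))
      (fun q hq => by
        obtain ⟨x, y, h1, h2, h3, h4⟩ := hop q (hin q hq)
        exact ⟨x, y, h1, h2, h3, h4.imp_right fun h =>
          ⟨h.1, h.2.1, fun u hu => h.2.2.1 u (hu.imp_right (hin u)), h.2.2.2⟩⟩)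
      ((Nat.add_le_add_right (Finset.card_le_card hsub) 2).trans hc)
    set R' := R ∪ P.image tgt with hR'
    set B' := B \ (P.image tgt : Finset V) with hB'
    set f : V → Set V := fun v => {u | u ∈ D ∪ P ∧ G.Adj u v} with hf
    have hWf : ∀ x ∈ W, f x = parents G x := by
      intro x hx
      ext u
      exact ⟨fun h => h.2, fun h => ⟨.inl (hWD x hx u h), h⟩⟩
    have hempty : ∀ x, (∀ u, u ∈ D ∨ u ∈ insert p P → ¬ G.Adj u x) → f x = ∅ := by
      intro x hx
      ext u
      simp only [hf, Set.mem_ofPred_eq, Set.mem_empty_iff_false, iff_false]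
      exact fun h => hx u (h.1.imp_right (hin u)) h.2
    have hnotR' : ∀ x, x ∉ R → (∀ u, u ∈ D ∨ u ∈ insert p P → ¬ G.Adj u x) → x ∉ R' := by
      intro x hx hu h
      rcases Finset.mem_union.1 h with h | h
      · exact hx h
      · obtain ⟨q, hq, rfl⟩ := Finset.mem_image.1 h
        exact hu q (.inr (hin q hq)) ((htgt q (hin q hq) _).2 rfl)
    have hpt : G.Adj p (tgt p) := (htgt p hself _).2 rfl
    have htne : ∀ x, (∀ u, u ∈ D ∨ u ∈ insert p P → ¬ G.Adj u x) → tgt p ≠ x := by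
      rintro x hx rfl
      exact hx p (.inr hself) hpt
    have hnew : p ∉ f (tgt p) := by
      rintro ⟨h | h, -⟩
      · exact (hPR p hself).2.2 h
      · exact hpP h
    -- The target is in fast memory if an earlier product of `P` was aggregated into it; otherwise
    -- its status is the one it had at the beginning.
    have ht : tgt p ∈ R' ∨ (tgt p ∉ B' ∧ f (tgt p) = ∅) := by
      by_cases h : ∃ q ∈ P, G.Adj q (tgt p)
      · obtain ⟨q, hq, h⟩ := h
        rw [htgt q (hin q hq)] at h
        exact .inl (Finset.mem_union_right _ (Finset.mem_image.2 ⟨q, hq, h.symm⟩))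
      · rcases hPt p hself with h' | ⟨h', h''⟩
        · exact .inl (Finset.mem_union_left _ h')
        · refine .inr ⟨fun hb => h' hb.1, ?_⟩
          ext u
          simp only [hf, Set.mem_ofPred_eq, Set.mem_empty_iff_false, iff_false]
          rintro ⟨hu | hu, hadj⟩
          · exact h'' u hu hadj
          · exact h ⟨u, hu, hadj⟩
    have hred : R ∪ (insert p P).image tgt = insert (tgt p) R' := by
      rw [Finset.image_insert, Finset.union_insert]
    have hWR' : W ⊆ R' := hWR.trans Finset.subset_union_left
    have hpp := hPp p hself
    have hfinal : progressState G (R ∪ (insert p P).image tgt)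
        (B \ ((insert p P).image tgt : Finset V)) (D ∪ (insert p P : Finset V)) =
        ⟨insert (tgt p) R', B' \ {tgt p}, Function.update f (tgt p) (insert p (f (tgt p)))⟩ := by
      unfold progressState
      congr 1
      · ext v
        simp only [hB', Finset.image_insert, Finset.coe_insert, Set.mem_sdiff, Set.mem_insert_iff,
          Set.mem_singleton_iff]
        tauto
      · funext v
        by_cases hv : v = tgt p
        · subst hv
          ext u
          simp only [hf, Finset.coe_insert, Set.mem_ofPred_eq, Function.update_self, Set.mem_union,
            Set.mem_insert_iff]
          constructor
          · tauto
          · rintro (rfl | h)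
            · exact ⟨.inr (.inl rfl), hpt⟩
            · tauto
        · rw [Function.update_of_ne hv]
          ext u
          simp only [hf, Finset.coe_insert, Set.mem_ofPred_eq, Set.mem_union, Set.mem_insert_iff]
          constructor
          · rintro ⟨h | rfl | h, h'⟩
            · exact ⟨.inl h, h'⟩
            · exact absurd ((htgt u hself v).1 h') hv
            · exact ⟨.inr h, h'⟩
          · tauto
    rw [hfinal]
    rw [hred] at hc
    refine h1.trans (c' := 0) ?_
    obtain ⟨x, y, hxy, hne, hy, hx | ⟨hxR, hxB, hxp, X, hX, hXne, hXW⟩⟩ := hop p hself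
    · exact PebbleRun.multiply_add hxy hne (hWR' hx) (hWf x hx) (hWR' hy) (hWf y hy)
        (hnotR' p (hPR p hself).1 hpp) (fun h => (hPR p hself).2.1 h.1) (hempty p hpp) hpt
        (htne p hpp) hnew ht (by omega)
    · refine PebbleRun.compute_multiply_add hxy (hnotR' x hxR hxp) (fun h => hxB h.1)
        (hempty x hxp) hX hXne (hXW.trans hWR') (fun z hz => hWf z (hXW hz)) (hWR' hy) (hWf y hy)
        (hnotR' p (hPR p hself).1 hpp) (fun h => (hPR p hself).2.1 h.1) (hempty p hpp) hpt
        (htne p hpp) (htne x hxp) ?_ hnew ht hc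
      rintro rfl
      exact hpp p (.inr hself) (show p ∈ parents G p by rw [hxy]; exact .inl rfl)

end Strategy

/-! ### A strategy for Approximate Attention -/

section AttentionStrategy

variable {n d g : ℕ}

/-- The node into which a scalar product is aggregated. -/
def AttnNode.target : AttnNode n d g → AttnNode n d g
  | .mulUV _ a j => .h a j
  | .mulUH i _ j => .out i j
  | x => x

theorem adj_mulUV_iff (i : Fin n) (a : Monomial d g) (j : Fin d) (v : AttnNode n d g) :
    (attentionDAG n d g).Adj (.mulUV i a j) v ↔ v = .h a j := by
  constructor
  · rintro ⟨⟩; rfl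
  · rintro rfl; exact .mul_h i a j

theorem adj_mulUH_iff (i : Fin n) (a : Monomial d g) (j : Fin d) (v : AttnNode n d g) :
    (attentionDAG n d g).Adj (.mulUH i a j) v ↔ v = .out i j := by
  constructor
  · rintro ⟨⟩; rfl
  · rintro rfl; exact .mul_out i a j

theorem parents_mulUV (i : Fin n) (a : Monomial d g) (j : Fin d) :
    parents (attentionDAG n d g) (.mulUV i a j) = {.u₂ i a, .v i j} := by
  ext u
  constructor
  · rintro ⟨⟩ <;> simp
  · rintro (rfl | rfl)
    · exact .u₂_mul i a j
    · exact .v_mul i a j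

theorem parents_mulUH (i : Fin n) (a : Monomial d g) (j : Fin d) :
    parents (attentionDAG n d g) (.mulUH i a j) = {.u₁ i a, .h a j} := by
  ext u
  constructor
  · rintro ⟨⟩ <;> simp
  · rintro (rfl | rfl)
    · exact .u₁_mul i a j
    · exact .h_mul i a j

theorem parents_u₁ (i : Fin n) (a : Monomial d g) :
    parents (attentionDAG n d g) (.u₁ i a) =
      (a.support.image (AttnNode.q i) : Finset (AttnNode n d g)) := by
  ext u
  simp only [Finset.coe_image, Set.mem_image, Finset.mem_coe, Monomial.mem_support]
  constructor
  · rintro ⟨⟩; exact ⟨_, ‹_›, rfl⟩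
  · rintro ⟨j, hj, rfl⟩; exact .q_u₁ i j a hj

theorem parents_u₂ (i : Fin n) (a : Monomial d g) :
    parents (attentionDAG n d g) (.u₂ i a) =
      (a.support.image (AttnNode.k i) : Finset (AttnNode n d g)) := by
  ext u
  simp only [Finset.coe_image, Set.mem_image, Finset.mem_coe, Monomial.mem_support]
  constructor
  · rintro ⟨⟩; exact ⟨_, ‹_›, rfl⟩
  · rintro ⟨j, hj, rfl⟩; exact .k_u₂ i j a hj

/-- The monomial of degree `0`. -/
def Monomial.unit (d g : ℕ) : Monomial d g := ⟨0, by simp⟩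

theorem Monomial.eq_unit_or_nonempty (a : Monomial d g) :
    a = Monomial.unit d g ∨ a.support.Nonempty := by
  rw [or_iff_not_imp_right, Finset.not_nonempty_iff_eq_empty]
  intro h
  apply Subtype.ext
  funext j
  by_contra hj
  simpa [h] using Monomial.mem_support.2 hj

theorem Monomial.support_unit : (Monomial.unit d g).support = ∅ := by
  ext j
  simp [Monomial.mem_support, Monomial.unit]

theorem isSource_u₁_unit (i : Fin n) :
    IsSource (attentionDAG n d g) (.u₁ i (Monomial.unit d g)) := by
  intro u h
  have : u ∈ parents (attentionDAG n d g) (.u₁ i (Monomial.unit d g)) := h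
  simp [parents_u₁, Monomial.support_unit] at this

theorem isSource_u₂_unit (i : Fin n) :
    IsSource (attentionDAG n d g) (.u₂ i (Monomial.unit d g)) := by
  intro u h
  have : u ∈ parents (attentionDAG n d g) (.u₂ i (Monomial.unit d g)) := h
  simp [parents_u₂, Monomial.support_unit] at this

/-- The products `U₂ i a * V i j` with `i ∈ I`, `a ∈ A`, `j ∈ J`. -/
def doneUV (A : Finset (Monomial d g)) (J : Finset (Fin d)) (I : Finset (Fin n)) :
    Set (AttnNode n d g) :=
  {v | ∃ i ∈ I, ∃ a ∈ A, ∃ j ∈ J, v = .mulUV i a j}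

/-- The products `U₁ i a * H a j` with `(i, a, j) ∈ Q`. -/
def doneUH (Q : Set (Fin n × Monomial d g × Fin d)) : Set (AttnNode n d g) :=
  {v | ∃ i a j, (i, a, j) ∈ Q ∧ v = .mulUH i a j}

/-- The inputs, and the outputs of the products in `Q`. -/
def storedNodes (Q : Set (Fin n × Monomial d g × Fin d)) : Set (AttnNode n d g) :=
  {v | IsSource (attentionDAG n d g) v ∨ ∃ i a j, (i, a, j) ∈ Q ∧ v = .out i j}

/-- The entries of `H` with row in `A` and column in `J`. -/
def blockH (n : ℕ) (A : Finset (Monomial d g)) (J : Finset (Fin d)) : Finset (AttnNode n d g) :=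
  (A ×ˢ J).image fun p => .h p.1 p.2

theorem card_blockH_le (A : Finset (Monomial d g)) (J : Finset (Fin d)) :
    (blockH n A J).card ≤ A.card * J.card := by
  rw [← Finset.card_product]
  exact Finset.card_image_le

theorem adj_of_done {Q : Set (Fin n × Monomial d g × Fin d)} {A : Finset (Monomial d g)}
    {J : Finset (Fin d)} {I : Finset (Fin n)} {u v : AttnNode n d g}
    (hu : u ∈ doneUH Q ∪ doneUV A J I) (h : (attentionDAG n d g).Adj u v) :
    (∃ i j, v = .out i j) ∨ ∃ a j, v = .h a j := by
  rcases hu with ⟨i, a, j, -, rfl⟩ | ⟨i, -, a, -, j, -, rfl⟩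
  · exact .inl ⟨i, j, (adj_mulUH_iff i a j v).1 h⟩
  · exact .inr ⟨a, j, (adj_mulUV_iff i a j v).1 h⟩

/-- One row of `U₂` and `V` is read and its contribution to a block of `H` is added. -/
theorem exists_run_rowH {M : ℕ} (i : Fin n) {S : Finset (Fin d)} {A : Finset (Monomial d g)}
    (J : Finset (Fin d)) (hA : A ⊆ monomialsIn g S) (Q : Set (Fin n × Monomial d g × Fin d))
    {I : Finset (Fin n)} (hi : i ∉ I) {R : Finset (AttnNode n d g)}
    (hR : R = blockH n A J ∨ (R = ∅ ∧ I = ∅))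
    (hc : (blockH n A J).card + S.card + J.card + 3 ≤ M) :
    ∃ c ≤ S.card + J.card + 1, PebbleRun (attentionDAG n d g) M
      (progressState (attentionDAG n d g) R (storedNodes Q) (doneUH Q ∪ doneUV A J I))
      (progressState (attentionDAG n d g) (blockH n A J) (storedNodes Q)
        (doneUH Q ∪ doneUV A J (insert i I))) c := by
  set T := blockH n A J with hT
  have hRT : R ⊆ T := by
    rcases hR with rfl | ⟨rfl, -⟩
    · exact subset_rfl
    · exact Finset.empty_subset _
  let W : Finset (AttnNode n d g) :=
    insert (.u₂ i (Monomial.unit d g)) (S.image (AttnNode.k i) ∪ J.image (AttnNode.v i))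
  have hWcard : W.card ≤ S.card + J.card + 1 := by
    refine (Finset.card_insert_le _ _).trans (Nat.add_le_add_right ?_ 1)
    exact (Finset.card_union_le _ _).trans
      (Nat.add_le_add Finset.card_image_le Finset.card_image_le)
  have hWsrc : ∀ x ∈ W, IsSource (attentionDAG n d g) x := by
    intro x hx
    simp only [W, Finset.mem_insert, Finset.mem_union, Finset.mem_image] at hx
    rcases hx with rfl | ⟨j, -, rfl⟩ | ⟨j, -, rfl⟩
    · exact isSource_u₂_unit i
    · exact isSource_k i j
    · exact isSource_v i j
  have hTmem : ∀ x ∈ T, ∃ a j, x = .h a j := by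
    intro x hx
    obtain ⟨p, -, rfl⟩ := Finset.mem_image.1 hx
    exact ⟨_, _, rfl⟩
  have hTsrc : ∀ x ∈ T, ¬ IsSource (attentionDAG n d g) x := by
    intro x hx h
    obtain ⟨a, j, rfl⟩ := hTmem x hx
    exact h _ (AttnEdge.mul_h i a j)
  have hTst : ∀ x ∈ T, x ∉ storedNodes Q := by
    rintro x hx (h | ⟨_, _, _, _, rfl⟩)
    · exact hTsrc x hx h
    · obtain ⟨_, _, h⟩ := hTmem _ hx
      cases h
  let P : Finset (AttnNode n d g) := (A ×ˢ J).image fun p => .mulUV i p.1 p.2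
  have hPmem : ∀ p ∈ P, ∃ a ∈ A, ∃ j ∈ J, p = .mulUV i a j := by
    intro p hp
    obtain ⟨⟨a, j⟩, h, rfl⟩ := Finset.mem_image.1 hp
    rw [Finset.mem_product] at h
    exact ⟨a, h.1, j, h.2, rfl⟩
  have hPT : P.image AttnNode.target = T := by
    rw [Finset.image_image]; rfl
  have hDP : doneUH Q ∪ doneUV A J I ∪ P = doneUH Q ∪ doneUV A J (insert i I) := by
    ext v
    simp only [P, doneUV, Set.mem_union, Finset.coe_image, Set.mem_image, Finset.mem_coe,
      Finset.mem_product, Set.mem_ofPred_eq, Finset.mem_insert, Prod.exists]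
    constructor
    · rintro ((h | ⟨i', h, h'⟩) | ⟨a, j, ⟨ha, hj⟩, rfl⟩)
      · exact .inl h
      · exact .inr ⟨i', .inr h, h'⟩
      · exact .inr ⟨i, .inl rfl, a, ha, j, hj, rfl⟩
    · rintro (h | ⟨i', rfl | h, a, ha, j, hj, rfl⟩)
      · exact .inl (.inl h)
      · exact .inr ⟨a, j, ⟨ha, hj⟩, rfl⟩
      · exact .inl (.inr ⟨i', h, a, ha, j, hj, rfl⟩)
  have hadj : ∀ u, u ∈ doneUH Q ∪ doneUV A J I ∨ u ∈ P → ∀ v, (attentionDAG n d g).Adj u v →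
      (∃ i j, v = .out i j) ∨ ∃ a j, v = .h a j := by
    intro u hu v h
    have : u ∈ doneUH Q ∪ doneUV A J (insert i I) := by rw [← hDP]; exact hu
    exact adj_of_done this h
  have hcard : (T ∪ W).card + 2 ≤ M := by
    have := Finset.card_union_le T W
    omega
  have hsubTW : R ∪ W ⊆ T ∪ W := Finset.union_subset_union_left hRT
  have h1 := PebbleRun.load_all (G := attentionDAG n d g) (M := M) (R := R) (B := storedNodes Q)
    (f := fun v => {u | u ∈ doneUH Q ∪ doneUV A J I ∧ (attentionDAG n d g).Adj u v}) W
    (fun x hx => .inl (hWsrc x hx)) ((Finset.card_le_card hsubTW).trans (by omega))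
  have hred : R ∪ W ∪ T = T ∪ W := by
    ext x
    simp only [Finset.mem_union]
    constructor
    · rintro ((h | h) | h)
      · exact .inl (hRT h)
      · exact .inr h
      · exact .inl h
    · tauto
  have h2 := PebbleRun.multiply_add_all (G := attentionDAG n d g) (M := M) (R := R ∪ W)
    (B := storedNodes Q) (D := doneUH Q ∪ doneUV A J I) W AttnNode.target P
    Finset.subset_union_right (fun x hx u h => absurd h (hWsrc x hx u))
    (by
      intro p hp
      obtain ⟨a, ha, j, hj, rfl⟩ := hPmem p hp
      refine ⟨?_, ?_, ?_⟩
      · intro h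
        rcases Finset.mem_union.1 h with h | h
        · obtain ⟨_, _, h⟩ := hTmem _ (hRT h)
          cases h
        · exact hWsrc _ h _ (AttnEdge.v_mul i a j)
      · rintro (h | ⟨_, _, _, _, h⟩)
        · exact h _ (AttnEdge.v_mul i a j)
        · cases h
      · rintro (⟨_, _, _, _, h⟩ | ⟨i', hi', _, _, _, _, h⟩)
        · cases h
        · cases h
          exact hi hi')
    (by
      intro p hp v
      obtain ⟨a, ha, j, hj, rfl⟩ := hPmem p hp
      exact adj_mulUV_iff i a j v)
    (by
      intro p hp u hu h
      obtain ⟨a, ha, j, hj, rfl⟩ := hPmem p hp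
      rcases hadj u hu _ h with ⟨_, _, h⟩ | ⟨_, _, h⟩ <;> cases h)
    (by
      intro p hp
      have hpT : p.target ∈ T := by rw [← hPT]; exact Finset.mem_image_of_mem _ hp
      -- Before the first row the block of H is not in fast memory; its entries are started by their
      -- first aggregation.
      rcases hR with hR | ⟨-, rfl⟩
      · exact .inl (Finset.mem_union_left _ (by rw [hR]; exact hpT))
      · refine .inr ⟨hTst _ hpT, ?_⟩
        obtain ⟨a, ha, j, hj, rfl⟩ := hPmem p hp
        rintro u (⟨i', a', j', -, rfl⟩ | ⟨i', hi', -⟩) h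
        · rw [adj_mulUH_iff] at h
          cases h
        · simp at hi')
    (by
      intro p hp
      obtain ⟨a, ha, j, hj, rfl⟩ := hPmem p hp
      refine ⟨.u₂ i a, .v i j, parents_mulUV i a j, by simp, by simp [W, hj], ?_⟩
      rcases a.eq_unit_or_nonempty with rfl | hne
      · exact .inl (Finset.mem_insert_self _ _)
      · obtain ⟨x, hx⟩ := hne
        have hxa : (attentionDAG n d g).Adj (.k i x) (.u₂ i a) :=
          .k_u₂ i x a (Monomial.mem_support.1 hx)
        refine .inr ⟨?_, ?_, ?_, _, parents_u₂ i a, ⟨_, Finset.mem_image_of_mem _ hx⟩, ?_⟩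
        · intro h
          rcases Finset.mem_union.1 h with h | h
          · obtain ⟨_, _, h⟩ := hTmem _ (hRT h)
            cases h
          · exact hWsrc _ h _ hxa
        · rintro (h | ⟨_, _, _, _, h⟩)
          · exact h _ hxa
          · cases h
        · intro u hu h
          rcases hadj u hu _ h with ⟨_, _, h⟩ | ⟨_, _, h⟩ <;> cases h
        · exact ((Finset.image_subset_image (mem_monomialsIn.1 (hA ha))).trans
            Finset.subset_union_left).trans (Finset.subset_insert _ _))
    (by rw [hPT, hred]; exact hcard)
  rw [hPT, hDP, hred] at h2
  have hB : storedNodes Q \ (T : Set (AttnNode n d g)) = storedNodes Q := by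
    ext x
    exact ⟨fun h => h.1, fun h => ⟨h, fun h' => hTst x h' h⟩⟩
  rw [hB] at h2
  have h3 := PebbleRun.delete_all (G := attentionDAG n d g) (M := M) (R := T ∪ W)
    (B := storedNodes Q) (f := fun v => {u | u ∈ doneUH Q ∪ doneUV A J (insert i I) ∧
      (attentionDAG n d g).Adj u v}) W Finset.subset_union_right
    (fun x hx => .inl (hWsrc x hx)) (by omega)
  have hTW : (T ∪ W) \ W = T := by
    ext x
    simp only [Finset.mem_sdiff, Finset.mem_union]
    constructor
    · tauto
    · exact fun h => ⟨.inl h, fun h' => hTsrc x h (hWsrc x h')⟩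
  rw [hTW] at h3
  exact ⟨_, by omega, (h1.trans h2).trans h3⟩

/-- One row of `U₁` is read and multiplied with a block of `H`. -/
theorem exists_run_rowOut {M : ℕ} (i : Fin n) {S : Finset (Fin d)} {A : Finset (Monomial d g)}
    (J : Finset (Fin d)) (hA : A ⊆ monomialsIn g S) (hne : A.Nonempty)
    (Q : Set (Fin n × Monomial d g × Fin d)) (hQ : ∀ a ∈ A, ∀ j ∈ J, (i, a, j) ∉ Q)
    (hc : (blockH n A J).card + S.card + J.card + 3 ≤ M) :
    ∃ c ≤ S.card + 2 * J.card + 1, PebbleRun (attentionDAG n d g) M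
      (progressState (attentionDAG n d g) (blockH n A J) (storedNodes Q)
        (doneUH Q ∪ doneUV A J Finset.univ))
      (progressState (attentionDAG n d g) (blockH n A J)
        (storedNodes (Q ∪ {p | p.1 = i ∧ p.2.1 ∈ A ∧ p.2.2 ∈ J}))
        (doneUH (Q ∪ {p | p.1 = i ∧ p.2.1 ∈ A ∧ p.2.2 ∈ J}) ∪ doneUV A J Finset.univ)) c := by
  classical
  set T := blockH n A J with hT
  set Q' := Q ∪ {p | p.1 = i ∧ p.2.1 ∈ A ∧ p.2.2 ∈ J} with hQ'
  let W : Finset (AttnNode n d g) :=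
    insert (.u₁ i (Monomial.unit d g)) (S.image (AttnNode.q i))
  let O : Finset (AttnNode n d g) := J.image (AttnNode.out i)
  -- The outputs with a partial sum from an earlier phase must be loaded; the others are started
  -- here.
  let X : Finset (AttnNode n d g) := O.filter fun x => x ∈ storedNodes Q
  have hWcard : W.card ≤ S.card + 1 :=
    (Finset.card_insert_le _ _).trans (Nat.add_le_add_right Finset.card_image_le 1)
  have hOcard : O.card ≤ J.card := Finset.card_image_le
  have hXO : X ⊆ O := Finset.filter_subset _ _
  have hXcard : X.card ≤ J.card := (Finset.card_le_card hXO).trans hOcard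
  have hWsrc : ∀ x ∈ W, IsSource (attentionDAG n d g) x := by
    intro x hx
    simp only [W, Finset.mem_insert, Finset.mem_image] at hx
    rcases hx with rfl | ⟨j, -, rfl⟩
    · exact isSource_u₁_unit i
    · exact isSource_q i j
  have hTmem : ∀ x ∈ T, ∃ a ∈ A, ∃ j, x = .h a j := by
    intro x hx
    obtain ⟨p, hp, rfl⟩ := Finset.mem_image.1 hx
    exact ⟨_, (Finset.mem_product.1 hp).1, _, rfl⟩
  have hTsrc : ∀ x ∈ T, ¬ IsSource (attentionDAG n d g) x := by
    intro x hx h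
    obtain ⟨a, -, j, rfl⟩ := hTmem x hx
    exact h _ (AttnEdge.mul_h i a j)
  have hOmem : ∀ x ∈ O, ∃ j ∈ J, x = .out i j := by
    intro x hx
    obtain ⟨j, hj, rfl⟩ := Finset.mem_image.1 hx
    exact ⟨_, hj, rfl⟩
  let P : Finset (AttnNode n d g) := (A ×ˢ J).image fun p => .mulUH i p.1 p.2
  have hPmem : ∀ p ∈ P, ∃ a ∈ A, ∃ j ∈ J, p = .mulUH i a j := by
    intro p hp
    obtain ⟨⟨a, j⟩, h, rfl⟩ := Finset.mem_image.1 hp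
    rw [Finset.mem_product] at h
    exact ⟨a, h.1, j, h.2, rfl⟩
  have hPO : P.image AttnNode.target = O := by
    ext x
    simp only [P, O, Finset.mem_image, Finset.mem_product, Prod.exists]
    constructor
    · rintro ⟨_, ⟨a, j, ⟨-, hj⟩, rfl⟩, rfl⟩
      exact ⟨j, hj, rfl⟩
    · rintro ⟨j, hj, rfl⟩
      obtain ⟨a, ha⟩ := hne
      exact ⟨_, ⟨a, j, ⟨ha, hj⟩, rfl⟩, rfl⟩
  have hDP : doneUH Q ∪ doneUV A J Finset.univ ∪ P = doneUH Q' ∪ doneUV A J Finset.univ := by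
    ext v
    constructor
    · rintro ((⟨i', a, j, h, rfl⟩ | h) | h)
      · exact .inl ⟨i', a, j, .inl h, rfl⟩
      · exact .inr h
      · obtain ⟨a, ha, j, hj, rfl⟩ := hPmem v h
        exact .inl ⟨i, a, j, .inr ⟨rfl, ha, hj⟩, rfl⟩
    · rintro (⟨i', a, j, h | ⟨h, ha, hj⟩, rfl⟩ | h)
      · exact .inl (.inl ⟨i', a, j, h, rfl⟩)
      · simp only at h ha hj
        subst h
        exact .inr (Finset.mem_coe.2 (Finset.mem_image.2
          ⟨(a, j), Finset.mem_product.2 ⟨ha, hj⟩, rfl⟩))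
      · exact .inl (.inr h)
  have hadj : ∀ u, u ∈ doneUH Q ∪ doneUV A J Finset.univ ∨ u ∈ P →
      ∀ v, (attentionDAG n d g).Adj u v → (∃ i j, v = .out i j) ∨ ∃ a j, v = .h a j := by
    intro u hu v h
    have : u ∈ doneUH Q' ∪ doneUV A J Finset.univ := by rw [← hDP]; exact hu
    exact adj_of_done this h
  have hcard : (T ∪ W ∪ O).card + 2 ≤ M := by
    have h1 := Finset.card_union_le (T ∪ W) O
    have h2 := Finset.card_union_le T W
    omega
  have h1 := PebbleRun.load_all (G := attentionDAG n d g) (M := M) (R := T) (B := storedNodes Q)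
    (f := fun v => {u | u ∈ doneUH Q ∪ doneUV A J Finset.univ ∧ (attentionDAG n d g).Adj u v})
    (W ∪ X) (by
      intro x hx
      rcases Finset.mem_union.1 hx with hx | hx
      · exact .inl (hWsrc x hx)
      · exact (Finset.mem_filter.1 hx).2)
    (by
      rw [← Finset.union_assoc]
      exact (Finset.card_le_card (Finset.union_subset_union_right hXO)).trans (by omega))
  have hred : T ∪ (W ∪ X) ∪ O = T ∪ W ∪ O := by
    ext x
    simp only [Finset.mem_union]
    constructor
    · rintro ((h | h | h) | h)
      · exact .inl (.inl h)
      · exact .inl (.inr h)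
      · exact .inr (hXO h)
      · exact .inr h
    · tauto
  have h2 := PebbleRun.multiply_add_all (G := attentionDAG n d g) (M := M) (R := T ∪ (W ∪ X))
    (B := storedNodes Q) (D := doneUH Q ∪ doneUV A J Finset.univ) (T ∪ W) AttnNode.target P
    (by
      rw [← Finset.union_assoc]
      exact Finset.subset_union_left)
    -- The entries of H in the block are final, because the contributions of all rows are in `doneUV
    -- A J Finset.univ`.
    (by
      intro x hx u h
      rcases Finset.mem_union.1 hx with hx | hx
      · obtain ⟨⟨a, j⟩, hp, rfl⟩ := Finset.mem_image.1 hx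
        rw [Finset.mem_product] at hp
        cases h
        exact .inr ⟨_, Finset.mem_univ _, _, hp.1, _, hp.2, rfl⟩
      · exact absurd h (hWsrc x hx u))
    (by
      intro p hp
      obtain ⟨a, ha, j, hj, rfl⟩ := hPmem p hp
      refine ⟨?_, ?_, ?_⟩
      · intro h
        rcases Finset.mem_union.1 h with h | h
        · obtain ⟨_, _, _, h⟩ := hTmem _ h
          cases h
        · rcases Finset.mem_union.1 h with h | h
          · exact hWsrc _ h _ (AttnEdge.h_mul i a j)
          · obtain ⟨_, _, h⟩ := hOmem _ (hXO h)
            cases h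
      · rintro (h | ⟨_, _, _, _, h⟩)
        · exact h _ (AttnEdge.h_mul i a j)
        · cases h
      · rintro (⟨_, _, _, h', h⟩ | ⟨i', hi', _, _, _, _, h⟩)
        · cases h
          exact hQ a ha j hj h'
        · cases h)
    (by
      intro p hp v
      obtain ⟨a, ha, j, hj, rfl⟩ := hPmem p hp
      exact adj_mulUH_iff i a j v)
    (by
      intro p hp u hu h
      obtain ⟨a, ha, j, hj, rfl⟩ := hPmem p hp
      rcases hadj u hu _ h with ⟨_, _, h⟩ | ⟨_, _, h⟩ <;> cases h)
    (by
      intro p hp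
      have hpO : p.target ∈ O := by rw [← hPO]; exact Finset.mem_image_of_mem _ hp
      by_cases hX : p.target ∈ X
      · exact .inl (Finset.mem_union_right _ (Finset.mem_union_right _ hX))
      · have hst : p.target ∉ storedNodes Q := fun h => hX (Finset.mem_filter.2 ⟨hpO, h⟩)
        refine .inr ⟨hst, ?_⟩
        obtain ⟨a, ha, j, hj, rfl⟩ := hPmem p hp
        rintro u (⟨i', a', j', h', rfl⟩ | ⟨i', hi', _, _, _, _, rfl⟩) h
        · rw [adj_mulUH_iff] at h
          cases h
          exact hst (.inr ⟨i, a', j, h', rfl⟩)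
        · rw [adj_mulUV_iff] at h
          cases h)
    (by
      intro p hp
      obtain ⟨a, ha, j, hj, rfl⟩ := hPmem p hp
      refine ⟨.u₁ i a, .h a j, parents_mulUH i a j, by simp, ?_, ?_⟩
      · exact Finset.mem_union_left _ (Finset.mem_image.2
          ⟨(a, j), Finset.mem_product.2 ⟨ha, hj⟩, rfl⟩)
      rcases a.eq_unit_or_nonempty with rfl | hne
      · exact .inl (Finset.mem_union_right _ (Finset.mem_insert_self _ _))
      · obtain ⟨x, hx⟩ := hne
        have hxa : (attentionDAG n d g).Adj (.q i x) (.u₁ i a) :=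
          .q_u₁ i x a (Monomial.mem_support.1 hx)
        refine .inr ⟨?_, ?_, ?_, _, parents_u₁ i a, ⟨_, Finset.mem_image_of_mem _ hx⟩, ?_⟩
        · intro h
          rcases Finset.mem_union.1 h with h | h
          · obtain ⟨_, _, _, h⟩ := hTmem _ h
            cases h
          · rcases Finset.mem_union.1 h with h | h
            · exact hWsrc _ h _ hxa
            · obtain ⟨_, _, h⟩ := hOmem _ (hXO h)
              cases h
        · rintro (h | ⟨_, _, _, _, h⟩)
          · exact h _ hxa
          · cases h
        · intro u hu h
          rcases hadj u hu _ h with ⟨_, _, h⟩ | ⟨_, _, h⟩ <;> cases h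
        · exact ((Finset.image_subset_image (mem_monomialsIn.1 (hA ha))).trans
            (Finset.subset_insert _ _)).trans Finset.subset_union_right)
    (by rw [hPO, hred]; exact hcard)
  rw [hPO, hDP, hred] at h2
  have h3 := PebbleRun.save_all (G := attentionDAG n d g) (M := M) (R := T ∪ W ∪ O)
    (B := storedNodes Q \ O) (f := fun v => {u | u ∈ doneUH Q' ∪ doneUV A J Finset.univ ∧
      (attentionDAG n d g).Adj u v}) O Finset.subset_union_right (by omega)
  have hB : storedNodes Q \ (O : Set (AttnNode n d g)) ∪ O = storedNodes Q' := by
    ext x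
    constructor
    · rintro (⟨h | ⟨i', a, j, h, rfl⟩, -⟩ | h)
      · exact .inl h
      · exact .inr ⟨i', a, j, .inl h, rfl⟩
      · obtain ⟨j, hj, rfl⟩ := hOmem x h
        obtain ⟨a, ha⟩ := hne
        exact .inr ⟨i, a, j, .inr ⟨rfl, ha, hj⟩, rfl⟩
    · intro h
      by_cases hx : x ∈ O
      · exact .inr hx
      · refine .inl ⟨?_, hx⟩
        rcases h with h | ⟨i', a, j, h | ⟨h, ha, hj⟩, rfl⟩
        · exact .inl h
        · exact .inr ⟨i', a, j, h, rfl⟩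
        · simp only at h hj
          subst h
          exact absurd (Finset.mem_image_of_mem _ hj) hx
  rw [hB] at h3
  have h4 := PebbleRun.delete_all (G := attentionDAG n d g) (M := M) (R := T ∪ W ∪ O)
    (B := storedNodes Q') (f := fun v => {u | u ∈ doneUH Q' ∪ doneUV A J Finset.univ ∧
      (attentionDAG n d g).Adj u v}) (W ∪ O)
    (by rw [Finset.union_assoc]; exact Finset.subset_union_right)
    (by
      intro x hx
      rcases Finset.mem_union.1 hx with hx | hx
      · exact .inl (hWsrc x hx)
      · rw [← hB]
        exact .inr hx) (by omega)
  have hTW : (T ∪ W ∪ O) \ (W ∪ O) = T := by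
    ext x
    simp only [Finset.mem_sdiff, Finset.mem_union]
    constructor
    · tauto
    · refine fun h => ⟨.inl (.inl h), ?_⟩
      rintro (h' | h')
      · exact hTsrc x h (hWsrc x h')
      · obtain ⟨_, _, _, rfl⟩ := hTmem x h
        obtain ⟨_, _, h⟩ := hOmem _ h'
        cases h
  rw [hTW] at h4
  have := Finset.card_union_le W X
  exact ⟨_, by omega, ((h1.trans h2).trans h3).trans h4⟩

end AttentionStrategy

/-! ### Phases of the strategy and their total cost -/

section Phases

variable {n d g : ℕ}

/-- All products with monomials in `A` and columns in `J` are added to the outputs. -/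
theorem exists_run_phase {M : ℕ} {S : Finset (Fin d)} {A : Finset (Monomial d g)}
    (J : Finset (Fin d)) (hn : 1 ≤ n) (hA : A ⊆ monomialsIn g S)
    (Q : Set (Fin n × Monomial d g × Fin d)) (hQ : ∀ i, ∀ a ∈ A, ∀ j ∈ J, (i, a, j) ∉ Q)
    (hc : (blockH n A J).card + S.card + J.card + 3 ≤ M) :
    ∃ c ≤ n * (2 * S.card + 3 * J.card + 2), PebbleRun (attentionDAG n d g) M
      (progressState (attentionDAG n d g) ∅ (storedNodes Q) (doneUH Q))
      (progressState (attentionDAG n d g) ∅ (storedNodes (Q ∪ {p | p.2.1 ∈ A ∧ p.2.2 ∈ J}))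
        (doneUH (Q ∪ {p | p.2.1 ∈ A ∧ p.2.2 ∈ J}))) c := by
  -- A variable set may have no monomial assigned to it. Then the phase is void, while
  -- `exists_run_rowOut` needs a product for each output that it saves.
  rcases A.eq_empty_or_nonempty with rfl | hne
  · refine ⟨0, Nat.zero_le _, ?_⟩
    have : ({p | p.2.1 ∈ (∅ : Finset (Monomial d g)) ∧ p.2.2 ∈ J} :
        Set (Fin n × Monomial d g × Fin d)) = ∅ := by
      ext p; simp
    rw [this, Set.union_empty]
    exact .refl _
  have hH : ∀ I : Finset (Fin n), ∃ R : Finset (AttnNode n d g),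
      (R = blockH n A J ∨ (R = ∅ ∧ I = ∅)) ∧ ∃ c ≤ I.card * (S.card + J.card + 1),
      PebbleRun (attentionDAG n d g) M
        (progressState (attentionDAG n d g) ∅ (storedNodes Q) (doneUH Q))
        (progressState (attentionDAG n d g) R (storedNodes Q) (doneUH Q ∪ doneUV A J I)) c := by
    intro I
    induction I using Finset.induction_on with
    | empty =>
      refine ⟨∅, .inr ⟨rfl, rfl⟩, 0, Nat.zero_le _, ?_⟩
      have : doneUV A J (∅ : Finset (Fin n)) = ∅ := by
        ext v; simp [doneUV]
      rw [this, Set.union_empty]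
      exact .refl _
    | insert i I hi ih =>
      obtain ⟨R, hR, c, hcost, hrun⟩ := ih
      obtain ⟨c', hcost', hrun'⟩ := exists_run_rowH i J hA Q hi hR hc
      refine ⟨_, .inl rfl, c + c', ?_, hrun.trans hrun'⟩
      rw [Finset.card_insert_of_notMem hi, add_mul, one_mul]
      exact Nat.add_le_add hcost hcost'
  have hOut : ∀ I : Finset (Fin n), ∃ c ≤ I.card * (S.card + 2 * J.card + 1),
      PebbleRun (attentionDAG n d g) M
        (progressState (attentionDAG n d g) (blockH n A J) (storedNodes Q)
          (doneUH Q ∪ doneUV A J Finset.univ))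
        (progressState (attentionDAG n d g) (blockH n A J)
          (storedNodes (Q ∪ {p | p.1 ∈ I ∧ p.2.1 ∈ A ∧ p.2.2 ∈ J}))
          (doneUH (Q ∪ {p | p.1 ∈ I ∧ p.2.1 ∈ A ∧ p.2.2 ∈ J}) ∪ doneUV A J Finset.univ)) c := by
    intro I
    induction I using Finset.induction_on with
    | empty =>
      refine ⟨0, Nat.zero_le _, ?_⟩
      have : ({p | p.1 ∈ (∅ : Finset (Fin n)) ∧ p.2.1 ∈ A ∧ p.2.2 ∈ J} :
          Set (Fin n × Monomial d g × Fin d)) = ∅ := by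
        ext p; simp
      rw [this, Set.union_empty]
      exact .refl _
    | insert i I hi ih =>
      obtain ⟨c, hcost, hrun⟩ := ih
      obtain ⟨c', hcost', hrun'⟩ := exists_run_rowOut i J hA hne
        (Q ∪ {p | p.1 ∈ I ∧ p.2.1 ∈ A ∧ p.2.2 ∈ J}) (by
          rintro a ha j hj (h | h)
          · exact hQ i a ha j hj h
          · exact hi h.1) hc
      have : Q ∪ {p | p.1 ∈ I ∧ p.2.1 ∈ A ∧ p.2.2 ∈ J} ∪ {p | p.1 = i ∧ p.2.1 ∈ A ∧ p.2.2 ∈ J} =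
          Q ∪ {p | p.1 ∈ insert i I ∧ p.2.1 ∈ A ∧ p.2.2 ∈ J} := by
        ext p
        simp only [Set.mem_union, Set.mem_ofPred_eq, Finset.mem_insert]
        tauto
      rw [this] at hrun'
      refine ⟨c + c', ?_, hrun.trans hrun'⟩
      rw [Finset.card_insert_of_notMem hi, add_mul, one_mul]
      exact Nat.add_le_add hcost hcost'
  obtain ⟨R, hR, c₁, hc₁, hrun₁⟩ := hH Finset.univ
  obtain ⟨c₂, hc₂, hrun₂⟩ := hOut Finset.univ
  have hR' : R = blockH n A J := by
    refine hR.resolve_right fun h => ?_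
    have := congrArg Finset.card h.2
    simp at this
    omega
  subst hR'
  -- The block of H is no longer needed and is discarded without ever being saved.
  have hclear := PebbleRun.clear_all (G := attentionDAG n d g) (M := M) (R := blockH n A J)
    (B := storedNodes (Q ∪ {p | p.2.1 ∈ A ∧ p.2.2 ∈ J}))
    (f := fun v => {u | u ∈ doneUH (Q ∪ {p | p.2.1 ∈ A ∧ p.2.2 ∈ J}) ∪ doneUV A J Finset.univ ∧
      (attentionDAG n d g).Adj u v}) (blockH n A J) (by
      intro x hx h
      obtain ⟨p, -, rfl⟩ := Finset.mem_image.1 hx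
      exact h _ (AttnEdge.mul_h ⟨0, by omega⟩ _ _)) (by omega)
  have hQ' : ({p | p.1 ∈ Finset.univ ∧ p.2.1 ∈ A ∧ p.2.2 ∈ J} :
      Set (Fin n × Monomial d g × Fin d)) = {p | p.2.1 ∈ A ∧ p.2.2 ∈ J} := by
    ext p; simp
  rw [hQ'] at hrun₂
  rw [Finset.card_univ, Fintype.card_fin] at hc₁ hc₂
  refine ⟨c₁ + c₂ + 0, ?_, ?_⟩
  · rw [add_zero]
    calc c₁ + c₂ ≤ n * (S.card + J.card + 1) + n * (S.card + 2 * J.card + 1) :=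
          Nat.add_le_add hc₁ hc₂
      _ = _ := by ring
  · refine (hrun₁.trans hrun₂).trans ?_
    refine cast (congrArg (fun s => PebbleRun _ M _ s 0) ?_) hclear
    symm
    rw [progressState, PebbleState.mk.injEq]
    refine ⟨by simp, ?_, ?_⟩
    · ext x
      refine ⟨fun h => ⟨h, fun h' => ?_⟩, fun h => h.1⟩
      obtain ⟨p, -, rfl⟩ := Finset.mem_image.1 h'
      rcases h with h | ⟨_, _, _, _, h⟩
      · exact h _ (AttnEdge.mul_h ⟨0, by omega⟩ _ _)
      · cases h
    · funext v
      split_ifs with hv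
      · obtain ⟨p, -, rfl⟩ := Finset.mem_image.1 hv
        ext u
        simp only [Set.mem_ofPred_eq, Set.mem_empty_iff_false, iff_false, not_and]
        rintro ⟨i, a, j, -, rfl⟩ h
        rw [adj_mulUH_iff] at h
        cases h
      · ext u
        constructor
        · exact fun h => ⟨.inl h.1, h.2⟩
        · rintro ⟨h | ⟨i, -, a, ha, j, hj, rfl⟩, h'⟩
          · exact ⟨h, h'⟩
          · rw [adj_mulUV_iff] at h'
            subst h'
            exact absurd (Finset.mem_image.2 ⟨(a, j), Finset.mem_product.2 ⟨ha, hj⟩, rfl⟩) hv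

/-- The monomial of degree `1` in the variable `j`. -/
def Monomial.var (hg : 1 ≤ g) (j : Fin d) : Monomial d g :=
  ⟨fun x => if x = j then ⟨1, by omega⟩ else 0, by simp [apply_ite Fin.val, hg]⟩

theorem Monomial.var_apply_ne (hg : 1 ≤ g) (j : Fin d) : (Monomial.var hg j).1 j ≠ 0 := by
  simp [Monomial.var, Fin.ext_iff]

theorem card_filter_div_eq_le (b k : ℕ) (hb : 1 ≤ b) :
    (Finset.univ.filter fun j : Fin d => (j : ℕ) / b = k).card ≤ b := by
  refine le_trans (Finset.card_le_card_of_injOn (t := Finset.range b) (fun j => (j : ℕ) % b) ?_ ?_)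
    (Finset.card_range b).le
  · intro j _
    exact Finset.mem_coe.2 (Finset.mem_range.2 (Nat.mod_lt _ hb))
  · intro j hj j' hj' h
    have h1 : (j : ℕ) / b = k := (Finset.mem_filter.1 hj).2
    have h2 : (j' : ℕ) / b = k := (Finset.mem_filter.1 hj').2
    apply Fin.ext
    rw [← Nat.div_add_mod j b, ← Nat.div_add_mod j' b, h1, h2]
    exact congrArg _ h

/-- A family `F` of sets of at most `s` variables that covers all monomials gives a strategy. -/
theorem exists_mem_ioCosts {M s b : ℕ} (hn : 1 ≤ n) (hd : 1 ≤ d) (hg : 1 ≤ g) (hb : 1 ≤ b)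
    (F : Finset (Finset (Fin d)))   (hs : ∀ S ∈ F, S.card ≤ s) (hF : ∀ a : Monomial d g, ∃ S ∈ F, a.support ⊆ S)
    (hM : tau g s * b + s + b + 3 ≤ M) :
    ∃ c ∈ ioCosts (attentionDAG n d g) M,
      c ≤ F.card * (d / b + 1) * (n * (2 * s + 3 * b + 2)) := by
  classical
  -- A monomial may be covered by several sets; `κ` fixes one, so that every product is added
  -- exactly once, in the phase given by `κ a` and the column block `j / b`.
  choose κ hκF hκ using hF
  let D : Finset (Finset (Fin d) × ℕ) → Set (Fin n × Monomial d g × Fin d) :=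
    fun E => {p | (κ p.2.1, (p.2.2 : ℕ) / b) ∈ E}
  have key : ∀ E ⊆ F ×ˢ Finset.range (d / b + 1), ∃ c ≤ E.card * (n * (2 * s + 3 * b + 2)),
      PebbleRun (attentionDAG n d g) M
        (progressState (attentionDAG n d g) ∅ (storedNodes ∅) (doneUH ∅))
        (progressState (attentionDAG n d g) ∅ (storedNodes (D E)) (doneUH (D E))) c := by
    intro E
    induction E using Finset.induction_on with
    | empty =>
      intro _
      refine ⟨0, Nat.zero_le _, ?_⟩
      have : D ∅ = ∅ := by ext p; simp [D]
      rw [this]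
      exact .refl _
    | insert e E he ih =>
      intro hE
      obtain ⟨c, hc, hrun⟩ := ih ((Finset.subset_insert _ _).trans hE)
      obtain ⟨S, k⟩ := e
      have hSF : S ∈ F := (Finset.mem_product.1 (hE (Finset.mem_insert_self _ _))).1
      let A : Finset (Monomial d g) := Finset.univ.filter fun a => κ a = S
      let J : Finset (Fin d) := Finset.univ.filter fun j => (j : ℕ) / b = k
      have hA : A ⊆ monomialsIn g S := by
        intro a ha
        rw [mem_monomialsIn, ← (Finset.mem_filter.1 ha).2]
        exact hκ a
      have hJ : J.card ≤ b := card_filter_div_eq_le b k hb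
      have hAcard : A.card ≤ tau g s :=
        (Finset.card_le_card hA).trans ((card_monomialsIn g S).le.trans (tau_mono g (hs S hSF)))
      have hcap : (blockH n A J).card + S.card + J.card + 3 ≤ M := by
        have h1 := card_blockH_le (n := n) A J
        have h2 := Nat.mul_le_mul hAcard hJ
        have h3 := hs S hSF
        omega
      obtain ⟨c', hc', hrun'⟩ := exists_run_phase J hn hA (D E) (by
        intro i a ha j hj h
        have h1 := (Finset.mem_filter.1 ha).2
        have h2 := (Finset.mem_filter.1 hj).2
        have h : (κ a, (j : ℕ) / b) ∈ E := h
        rw [h1, h2] at h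
        exact he h) hcap
      have hD : D E ∪ {p | p.2.1 ∈ A ∧ p.2.2 ∈ J} = D (insert (S, k) E) := by
        ext p
        simp only [D, A, J, Set.mem_union, Set.mem_ofPred_eq, Finset.mem_filter, Finset.mem_univ,
          true_and, Finset.mem_insert, Prod.mk.injEq]
        tauto
      rw [hD] at hrun'
      refine ⟨c + c', ?_, hrun.trans hrun'⟩
      rw [Finset.card_insert_of_notMem he, add_mul, one_mul]
      refine Nat.add_le_add hc (hc'.trans (Nat.mul_le_mul_left n ?_))
      have := hs S hSF
      omega
  obtain ⟨c, hc, hrun⟩ := key _ subset_rfl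
  have hall : D (F ×ˢ Finset.range (d / b + 1)) = Set.univ := by
    ext p
    simp only [D, Set.mem_ofPred_eq, Set.mem_univ, iff_true, Finset.mem_product, Finset.mem_range]
    exact ⟨hκF _, Nat.lt_succ_of_le (Nat.div_le_div_right p.2.2.isLt.le)⟩
  have hinit : progressState (attentionDAG n d g) ∅ (storedNodes ∅) (doneUH ∅) =
      initialState (attentionDAG n d g) := by
    unfold progressState initialState
    congr 1
    · ext v; simp [storedNodes]
    · funext v; ext u; simp [doneUH]
  rw [hall, hinit] at hrun
  rw [Finset.card_product, Finset.card_range] at hc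
  refine ⟨c, ⟨_, hrun, ?_⟩, hc⟩
  intro v hv
  cases v with
  | out i j =>
    refine ⟨.inr ⟨i, Monomial.unit d g, j, trivial, rfl⟩, ?_⟩
    ext u
    refine ⟨fun h => h.2, fun h => ⟨?_, h⟩⟩
    rw [parents_out] at h
    obtain ⟨a, rfl⟩ := h
    exact ⟨i, a, j, trivial, rfl⟩
  -- Only outputs are sinks. For entries of Q and K a child is a monomial of degree 1, which exists
  -- because g ≥ 1.
  | q i j => exact absurd (AttnEdge.q_u₁ i j _ (Monomial.var_apply_ne hg j)) (hv _)
  | k i j => exact absurd (AttnEdge.k_u₂ i j _ (Monomial.var_apply_ne hg j)) (hv _)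
  | v i j => exact absurd (AttnEdge.v_mul i (Monomial.unit d g) j) (hv _)
  | u₁ i a => exact absurd (AttnEdge.u₁_mul i a ⟨0, hd⟩) (hv _)
  | u₂ i a => exact absurd (AttnEdge.u₂_mul i a ⟨0, hd⟩) (hv _)
  | mulUV i a j => exact absurd (AttnEdge.mul_h i a j) (hv _)
  | h a j => exact absurd (AttnEdge.h_mul ⟨0, hn⟩ a j) (hv _)
  | mulUH i a j => exact absurd (AttnEdge.mul_out i a j) (hv _)

end Phases

/-! ### Covering the monomials by few sets of variables -/

section Covering

/-- This is (1 + k/g)^g ≤ e^k. Relative errors of order 1/g in each of `g` factors therefore cost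
only a constant; the cases k = 2 and k = 6 are used. -/
theorem add_pow_le_exp_mul_pow {g : ℕ} (hg : 1 ≤ g) (k : ℕ) :
    ((g + k : ℕ) : ℝ) ^ g ≤ Real.exp k * (g : ℝ) ^ g := by
  have hg' : (0 : ℝ) < g := by exact_mod_cast hg
  have h1 : ((g + k : ℕ) : ℝ) = ((k : ℝ) / g + 1) * g := by
    push_cast
    field_simp
    ring
  rw [h1, mul_pow]
  refine mul_le_mul_of_nonneg_right ?_ (by positivity)
  calc ((k : ℝ) / g + 1) ^ g ≤ Real.exp (k / g) ^ g :=
        pow_le_pow_left₀ (by positivity) (Real.add_one_le_exp _) _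
    _ = Real.exp k := by
        rw [← Real.exp_nat_mul]
        congr 1
        field_simp

theorem add_two_pow_le {g : ℕ} (hg : 1 ≤ g) : (g + 2) ^ g ≤ 8 * g ^ g := by
  have h1 := add_pow_le_exp_mul_pow hg 2
  have h2 : Real.exp (2 : ℕ) ≤ 8 := by
    have h3 : Real.exp (2 : ℕ) = Real.exp 1 * Real.exp 1 := by
      rw [← Real.exp_add]; norm_num
    rw [h3]
    nlinarith [Real.exp_one_lt_d9, Real.exp_pos 1]
  have h3 : ((g + 2 : ℕ) : ℝ) ^ g ≤ 8 * (g : ℝ) ^ g :=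
    h1.trans (mul_le_mul_of_nonneg_right h2 (by positivity))
  exact_mod_cast h3

theorem add_six_pow_le {g : ℕ} (hg : 1 ≤ g) : (g + 6) ^ g ≤ 729 * g ^ g := by
  have h1 := add_pow_le_exp_mul_pow hg 6
  have h2 : Real.exp (6 : ℕ) ≤ 729 := by
    have h3 : Real.exp (6 : ℕ) = Real.exp 1 ^ 6 := by
      rw [← Real.exp_nat_mul]; norm_num
    rw [h3]
    calc Real.exp 1 ^ 6 ≤ 3 ^ 6 :=
          pow_le_pow_left₀ (Real.exp_pos 1).le (by linarith [Real.exp_one_lt_d9]) _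
      _ = 729 := by norm_num
  have h3 : ((g + 6 : ℕ) : ℝ) ^ g ≤ 729 * (g : ℝ) ^ g :=
    h1.trans (mul_le_mul_of_nonneg_right h2 (by positivity))
  exact_mod_cast h3

/-- In g!·τ(x) = (x+1)⋯(x+g), every factor grows by at most 1 + 2/g when `w` is replaced by `s`, and
(1 + 2/g)^g ≤ e² < 8. -/
theorem tau_le_of_mul_le {g s w : ℕ} (hg : 1 ≤ g) (h : g * s ≤ (g + 2) * w) :
    tau g s ≤ 8 * tau g w := by
  have key : ∀ x, g.factorial * tau g x = ∏ i ∈ Finset.range g, (x + 1 + i) := by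
    intro x
    rw [tau, ← Nat.ascFactorial_eq_prod_range, Nat.ascFactorial_eq_factorial_mul_choose]
  have h1 : g ^ g * ∏ i ∈ Finset.range g, (s + 1 + i) ≤
      (g + 2) ^ g * ∏ i ∈ Finset.range g, (w + 1 + i) := by
    have hp : ∀ a : ℕ, a ^ g = ∏ _i ∈ Finset.range g, a := fun a => by simp
    rw [hp g, hp (g + 2), ← Finset.prod_mul_distrib, ← Finset.prod_mul_distrib]
    refine Finset.prod_le_prod' fun i _ => ?_
    nlinarith
  rw [← key, ← key] at h1
  have h2 : g ^ g * (g.factorial * tau g s) ≤ g ^ g * (g.factorial * (8 * tau g w)) := by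
    refine h1.trans ((Nat.mul_le_mul_right _ (add_two_pow_le hg)).trans (le_of_eq (by ring)))
  exact Nat.le_of_mul_le_mul_left (Nat.le_of_mul_le_mul_left h2 (by positivity))
    (Nat.factorial_pos g)

/-- The factors are compared one by one: g·(d-i)·(g+2-i) ≤ (g+6)·(B-i)·(w-i) for i < g. The gain
C(g+2,g), of order g², is what the greedy cover needs. -/
theorem choose_mul_choose_le {d g w B : ℕ} (hg : 1 ≤ g) (hw : 2 * g ≤ w) (hB : g + 2 ≤ B)
    (hwd : w ≤ d) (h : d * g ≤ w * (B + 1)) :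
    d.choose g * (g + 2).choose g ≤ 729 * (B.choose g * w.choose g) := by
  have key : ∀ x, g.factorial * x.choose g = ∏ i ∈ Finset.range g, (x - i) := by
    intro x
    rw [← Nat.descFactorial_eq_prod_range, Nat.descFactorial_eq_factorial_mul_choose]
  have h1 : g ^ g * ((∏ i ∈ Finset.range g, (d - i)) * ∏ i ∈ Finset.range g, (g + 2 - i)) ≤
      (g + 6) ^ g * ((∏ i ∈ Finset.range g, (B - i)) * ∏ i ∈ Finset.range g, (w - i)) := by
    have hp : ∀ a : ℕ, a ^ g = ∏ _i ∈ Finset.range g, a := fun a => by simp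
    rw [hp g, hp (g + 6), ← Finset.prod_mul_distrib, ← Finset.prod_mul_distrib,
      ← Finset.prod_mul_distrib, ← Finset.prod_mul_distrib]
    refine Finset.prod_le_prod' fun i hi => ?_
    rw [Finset.mem_range] at hi
    -- With B = g + 2 + t, w = 2g + v and g = i + e + 1, the inequality becomes the positivity of a
    -- polynomial in i, e, t, v with nonnegative coefficients.
    obtain ⟨t, rfl⟩ := Nat.exists_eq_add_of_le hB
    obtain ⟨v, rfl⟩ := Nat.exists_eq_add_of_le hw
    obtain ⟨e, rfl⟩ := Nat.exists_eq_add_of_lt hi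
    zify [show i ≤ d by omega, show i ≤ i + e + 1 + 2 by omega, show i ≤ i + e + 1 + 2 + t by omega,
      show i ≤ 2 * (i + e + 1) + v by omega]
    zify at h
    have h2 : ((d : ℤ) - i) * (i + e + 1) ≤
        (2 * (i + e + 1) + v) * (i + e + 1 + 2 + t + 1) - i * (i + e + 1) := by
      linarith
    have h3 := mul_le_mul_of_nonneg_right h2 (show (0 : ℤ) ≤ e + 3 by positivity)
    have h4 : ((2 * (i + e + 1) + v : ℤ) * (i + e + 1 + 2 + t + 1) - i * (i + e + 1)) * (e + 3) ≤
        (i + e + 1 + 6) * ((e + 3 + t) * (i + 2 * e + 2 + v)) := by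
      have hi0 : (0 : ℤ) ≤ i := by positivity
      have he0 : (0 : ℤ) ≤ e := by positivity
      have hv0 : (0 : ℤ) ≤ v := by positivity
      have ht0 : (0 : ℤ) ≤ t := by positivity
      rw [← sub_nonneg]
      ring_nf
      positivity
    linarith
  rw [← key, ← key, ← key, ← key] at h1
  have h2 : g ^ g * (g.factorial * g.factorial * (d.choose g * (g + 2).choose g)) ≤
      g ^ g * (g.factorial * g.factorial * (729 * (B.choose g * w.choose g))) := by
    calc _ = g ^ g * (g.factorial * d.choose g * (g.factorial * (g + 2).choose g)) := by ring
      _ ≤ _ := h1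
      _ ≤ 729 * g ^ g * (g.factorial * B.choose g * (g.factorial * w.choose g)) :=
        Nat.mul_le_mul_right _ (add_six_pow_le hg)
      _ = _ := by ring
  exact Nat.le_of_mul_le_mul_left (Nat.le_of_mul_le_mul_left h2 (by positivity))
    (Nat.mul_pos (Nat.factorial_pos g) (Nat.factorial_pos g))

variable {d g : ℕ}

/-- Unions of `g` groups of consecutive variables. -/
theorem exists_cover_of_groups {w B : ℕ} (hg : g ≤ B) (hB : 1 ≤ B) (hw : g * g ≤ w)
    (h : d * g ≤ w * (B + 1)) :
    ∃ (s : ℕ) (F : Finset (Finset (Fin d))), (∀ S ∈ F, S.card ≤ s) ∧ g * s ≤ (g + 2) * w ∧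
      (∀ X : Finset (Fin d), X.card ≤ g → ∃ S ∈ F, X ⊆ S) ∧ F.card ≤ B.choose g := by
  classical
  -- This length exceeds d/B, so `B` intervals of length `q` cover all `d` variables.
  set q := d / B + 1 with hq
  refine ⟨q * g, (Finset.powersetCard g (Finset.range B)).image fun E =>
    Finset.univ.filter fun x : Fin d => (x : ℕ) / q ∈ E, ?_, ?_, ?_, ?_⟩
  · intro S hS
    obtain ⟨E, hE, rfl⟩ := Finset.mem_image.1 hS
    rw [← (Finset.mem_powersetCard.1 hE).2]
    refine Finset.card_le_mul_card_image_of_maps_to (f := fun x : Fin d => (x : ℕ) / q)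
      (fun x hx => (Finset.mem_filter.1 hx).2) q fun k _ => ?_
    refine (Finset.card_le_card ?_).trans (card_filter_div_eq_le (d := d) q k (Nat.le_add_left 1 _))
    intro x hx
    exact Finset.mem_filter.2 ⟨Finset.mem_univ _, (Finset.mem_filter.1 hx).2⟩
  · have h1 : d / B * B ≤ d := Nat.div_mul_le_self _ _
    set e := d / B
    -- Having B + 1 instead of B in the hypothesis costs one `w` (as g ≤ B), and the summand 1 in
    -- `q` costs g² ≤ w; together this gives (g + 2)·w.
    have h2 : g * (g * e) * B ≤ (g * w + w) * B := by
      calc g * (g * e) * B = g * (g * (e * B)) := by ring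
        _ ≤ g * (g * d) := Nat.mul_le_mul_left _ (Nat.mul_le_mul_left _ h1)
        _ = g * (d * g) := by ring
        _ ≤ g * (w * (B + 1)) := Nat.mul_le_mul_left _ h
        _ = g * w * B + w * g := by ring
        _ ≤ g * w * B + w * B := Nat.add_le_add_left (Nat.mul_le_mul_left _ hg) _
        _ = (g * w + w) * B := by ring
    have h3 := Nat.le_of_mul_le_mul_right h2 hB
    rw [hq]
    nlinarith
  · intro X hX
    have hsub : X.image (fun x : Fin d => (x : ℕ) / q) ⊆ Finset.range B := by
      intro k hk
      obtain ⟨x, -, rfl⟩ := Finset.mem_image.1 hk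
      rw [Finset.mem_range]
      refine Nat.div_lt_of_lt_mul ?_
      have := Nat.lt_mul_div_succ d hB
      rw [mul_comm]
      exact x.isLt.trans this
    obtain ⟨E, hE1, hE2, hE3⟩ := Finset.exists_subsuperset_card_eq hsub
      (Finset.card_image_le.trans hX) (by simpa using hg)
    refine ⟨_, Finset.mem_image.2 ⟨E, Finset.mem_powersetCard.2 ⟨hE2, hE3⟩, rfl⟩, fun x hx => ?_⟩
    exact Finset.mem_filter.2 ⟨Finset.mem_univ _, hE1 (Finset.mem_image_of_mem _ hx)⟩
  · refine Finset.card_image_le.trans ?_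
    rw [Finset.card_powersetCard, Finset.card_range]

/-- Some `w`-set contains at least the average number of members of a family of `g`-sets. -/
theorem exists_card_eq_and_le_card_filter_subset {w : ℕ} (hgw : g ≤ w) (hwd : w ≤ d)
    (U : Finset (Finset (Fin d))) (hU : ∀ X ∈ U, X.card = g) :
    ∃ S : Finset (Fin d), S.card = w ∧
      U.card * w.choose g ≤ (U.filter fun X => X ⊆ S).card * d.choose g := by
  by_contra! hcon
  have hlt : ∑ S ∈ Finset.powersetCard w (Finset.univ : Finset (Fin d)),
      (U.filter fun X => X ⊆ S).card * d.choose g <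
      ∑ _S ∈ Finset.powersetCard w (Finset.univ : Finset (Fin d)), U.card * w.choose g := by
    refine Finset.sum_lt_sum_of_nonempty ?_ fun S hS => hcon S (Finset.mem_powersetCard.1 hS).2
    rw [Finset.powersetCard_nonempty]
    simpa using hwd
  rw [← Finset.sum_mul, Finset.sum_const, Finset.card_powersetCard, Finset.card_univ,
    Fintype.card_fin, smul_eq_mul] at hlt
  have hcomm := Finset.sum_card_bipartiteAbove_eq_sum_card_bipartiteBelow
    (s := Finset.powersetCard w (Finset.univ : Finset (Fin d))) (t := U) fun S X => X ⊆ S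
  simp only [Finset.bipartiteAbove, Finset.bipartiteBelow] at hcomm
  -- Double counting of pairs X ⊆ S: the complement of X has C(d-g, w-g) subsets of size w - g, and
  -- each extends X to a different w-set.
  have hsup : ∀ X ∈ U, (d - g).choose (w - g) ≤
      ((Finset.powersetCard w (Finset.univ : Finset (Fin d))).filter fun S => X ⊆ S).card := by
    intro X hX
    have h1 : (Finset.powersetCard (w - g) Xᶜ).card = (d - g).choose (w - g) := by
      rw [Finset.card_powersetCard, Finset.card_compl, Fintype.card_fin, hU X hX]
    rw [← h1]
    refine Finset.card_le_card_of_injOn (fun T => T ∪ X) ?_ ?_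
    · intro T hT
      have hT := Finset.mem_powersetCard.1 hT
      refine Finset.mem_coe.2 (Finset.mem_filter.2 ⟨Finset.mem_powersetCard.2
        ⟨Finset.subset_univ _, ?_⟩, Finset.subset_union_right⟩)
      rw [Finset.card_union_of_disjoint, hT.2, hU X hX]
      · omega
      · exact (Finset.subset_compl_iff_disjoint_right).1 hT.1
    · intro T hT T' hT' h
      have hT := (Finset.mem_powersetCard.1 hT).1
      have hT' := (Finset.mem_powersetCard.1 hT').1
      have h2 : ∀ T : Finset (Fin d), T ⊆ Xᶜ → (T ∪ X) \ X = T := by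
        intro T hT
        rw [Finset.union_sdiff_right]
        exact Finset.sdiff_eq_self_of_disjoint (Finset.subset_compl_iff_disjoint_right.1 hT)
      rw [← h2 T hT, ← h2 T' hT']
      exact congrArg (· \ X) h
  have hle : U.card * (d - g).choose (w - g) ≤ ∑ X ∈ U,
      ((Finset.powersetCard w (Finset.univ : Finset (Fin d))).filter fun S => X ⊆ S).card := by
    rw [← smul_eq_mul, ← Finset.sum_const]
    exact Finset.sum_le_sum hsup
  rw [hcomm] at hlt
  have h2 := Nat.mul_le_mul_right (d.choose g) hle
  have h3 := Nat.choose_mul (n := d) (k := w) (s := g) hgw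
  have h4 : U.card * (d - g).choose (w - g) * d.choose g =
      d.choose w * (U.card * w.choose g) := by
    calc _ = U.card * (d.choose g * (d - g).choose (w - g)) := by ring
      _ = U.card * (d.choose w * w.choose g) := by rw [h3]
      _ = _ := by ring
  omega

/-- Each new w-set is chosen to contain at least the average share C(w,g)/C(d,g) of the g-sets that
are still uncovered. -/
theorem exists_greedy_cover {w : ℕ} (hgw : g ≤ w) (hwd : w ≤ d) (N : ℕ) :
    ∃ F : Finset (Finset (Fin d)), F.card ≤ N ∧ (∀ S ∈ F, S.card = w) ∧
      (((Finset.powersetCard g (Finset.univ : Finset (Fin d))).filter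
        fun X => ∀ S ∈ F, ¬ X ⊆ S).card : ℝ) ≤
        d.choose g * (1 - (w.choose g : ℝ) / d.choose g) ^ N := by
  classical
  have hpos : (0 : ℝ) < d.choose g := by exact_mod_cast Nat.choose_pos (hgw.trans hwd)
  induction N with
  | zero =>
    refine ⟨∅, by simp, by simp, ?_⟩
    simp
  | succ N ih =>
    obtain ⟨F, hF, hFw, hcov⟩ := ih
    set U := (Finset.powersetCard g (Finset.univ : Finset (Fin d))).filter
      fun X => ∀ S ∈ F, ¬ X ⊆ S with hU
    obtain ⟨S, hS, hSU⟩ := exists_card_eq_and_le_card_filter_subset hgw hwd U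
      fun X hX => (Finset.mem_powersetCard.1 (Finset.mem_filter.1 hX).1).2
    refine ⟨insert S F, (Finset.card_insert_le _ _).trans (by omega), ?_, ?_⟩
    · intro T hT
      rcases Finset.mem_insert.1 hT with rfl | hT
      · exact hS
      · exact hFw T hT
    · have h1 : (Finset.powersetCard g (Finset.univ : Finset (Fin d))).filter
          (fun X => ∀ T ∈ insert S F, ¬ X ⊆ T) = U.filter fun X => ¬ X ⊆ S := by
        ext X
        simp only [hU, Finset.mem_filter, Finset.mem_insert, forall_eq_or_imp]
        tauto
      have h2 := Finset.card_filter_add_card_filter_not (s := U) fun X => X ⊆ S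
      have h3 : (U.card : ℝ) * ((w.choose g : ℝ) / d.choose g) ≤
          (U.filter fun X => X ⊆ S).card := by
        rw [mul_div_assoc', div_le_iff₀ hpos]
        exact_mod_cast hSU
      have h4 : ((U.filter fun X => ¬ X ⊆ S).card : ℝ) =
          U.card - (U.filter fun X => X ⊆ S).card := by
        rw [← h2]; push_cast; ring
      have h5 : (w.choose g : ℝ) / d.choose g ≤ 1 := by
        rw [div_le_one hpos]
        exact_mod_cast Nat.choose_le_choose g hwd
      rw [h1, h4, pow_succ]
      have h6 := mul_le_mul_of_nonneg_right hcov (sub_nonneg.2 h5)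
      nlinarith

/-- Greedy covering of all `g`-sets by `w`-sets. -/
theorem exists_cover_of_greedy {w : ℕ} (hg : 1 ≤ g) (hgw : g ≤ w) (hwd : w ≤ d) :
    ∃ F : Finset (Finset (Fin d)), (∀ S ∈ F, S.card ≤ w) ∧
      (∀ X : Finset (Fin d), X.card ≤ g → ∃ S ∈ F, X ⊆ S) ∧
      F.card * w.choose g ≤ 3 * w * d.choose g := by
  classical
  have hd0 : (0 : ℝ) < d.choose g := by exact_mod_cast Nat.choose_pos (hgw.trans hwd)
  have hw0 : (0 : ℝ) < w.choose g := by exact_mod_cast Nat.choose_pos hgw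
  set p : ℝ := (w.choose g : ℝ) / d.choose g with hp
  have hp0 : 0 < p := div_pos hw0 hd0
  have hp1 : p ≤ 1 := by
    rw [hp, div_le_one hd0]
    exact_mod_cast Nat.choose_le_choose g hwd
  -- Every ⌈1/p⌉ steps halve the bound on the uncovered g-sets, since (1-p)^(1/p) ≤ 1/e. After `w`
  -- such rounds at most C(d,g)/2^w ≤ 1/p are left, as C(w,g) ≤ 2^w; these are added to the family
  -- as they are.
  obtain ⟨F, hF, hFw, hcov⟩ := exists_greedy_cover hgw hwd (w * ⌈1 / p⌉₊)
  set U := (Finset.powersetCard g (Finset.univ : Finset (Fin d))).filter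
      fun X => ∀ S ∈ F, ¬ X ⊆ S with hU
  have hUcard : (U.card : ℝ) ≤ 1 / p := by
    have h1 : (1 - p) ^ (w * ⌈1 / p⌉₊) ≤ 1 / w.choose g := by
      have h2 : (1 : ℝ) / p ≤ ⌈1 / p⌉₊ := Nat.le_ceil _
      have h3 : (1 - p) ^ ⌈1 / p⌉₊ ≤ 1 / 2 := by
        calc (1 - p) ^ ⌈1 / p⌉₊ ≤ Real.exp (-p) ^ ⌈1 / p⌉₊ :=
              pow_le_pow_left₀ (by linarith) (Real.one_sub_le_exp_neg p) _
          _ = Real.exp (-(⌈1 / p⌉₊ * p)) := by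
              rw [← Real.exp_nat_mul]; congr 1; ring
          _ ≤ Real.exp (-1) := by
              rw [div_le_iff₀ hp0] at h2
              exact Real.exp_le_exp.2 (by linarith)
          _ ≤ 1 / 2 := by
              rw [Real.exp_neg, ← one_div]
              exact one_div_le_one_div_of_le (by norm_num) (by linarith [Real.exp_one_gt_d9])
      calc (1 - p) ^ (w * ⌈1 / p⌉₊) = ((1 - p) ^ ⌈1 / p⌉₊) ^ w := by rw [mul_comm, pow_mul]
        _ ≤ (1 / 2) ^ w := pow_le_pow_left₀ (pow_nonneg (by linarith) _) h3 _
        _ = 1 / 2 ^ w := by rw [one_div_pow]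
        _ ≤ 1 / w.choose g := by
            refine one_div_le_one_div_of_le hw0 ?_
            exact_mod_cast Nat.choose_le_two_pow w g
    refine hcov.trans ((mul_le_mul_of_nonneg_left h1 hd0.le).trans (le_of_eq ?_))
    rw [hp]
    field_simp
  refine ⟨F ∪ U, ?_, ?_, ?_⟩
  · intro S hS
    rcases Finset.mem_union.1 hS with h | h
    · exact (hFw S h).le
    · exact (Finset.mem_powersetCard.1 (Finset.mem_filter.1 h).1).2.le.trans hgw
  · intro X hX
    obtain ⟨Y, hXY, -, hY⟩ := Finset.exists_subsuperset_card_eq (Finset.subset_univ X) hX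
      (by simpa using hgw.trans hwd)
    by_cases h : ∃ S ∈ F, Y ⊆ S
    · obtain ⟨S, hS, hYS⟩ := h
      exact ⟨S, Finset.mem_union_left _ hS, hXY.trans hYS⟩
    · push Not at h
      exact ⟨Y, Finset.mem_union_right _ (Finset.mem_filter.2
        ⟨Finset.mem_powersetCard.2 ⟨Finset.subset_univ _, hY⟩, h⟩), hXY⟩
  · have hw1 : (1 : ℝ) ≤ w := by exact_mod_cast hg.trans hgw
    have h1 : ((F ∪ U).card : ℝ) ≤ F.card + U.card := by exact_mod_cast Finset.card_union_le F U
    have h2 : (F.card : ℝ) ≤ w * ⌈1 / p⌉₊ := by exact_mod_cast hF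
    have h3 : (⌈1 / p⌉₊ : ℝ) < 1 / p + 1 := Nat.ceil_lt_add_one (by positivity)
    have h4 : 1 ≤ 1 / p := by rwa [le_div_iff₀ hp0, one_mul]
    have h5 : ((F ∪ U).card : ℝ) ≤ 3 * w * (1 / p) := by nlinarith
    have h6 : ((F ∪ U).card : ℝ) * w.choose g ≤ 3 * w * d.choose g := by
      calc ((F ∪ U).card : ℝ) * w.choose g ≤ 3 * w * (1 / p) * w.choose g :=
            mul_le_mul_of_nonneg_right h5 hw0.le
        _ = 3 * w * d.choose g := by
            rw [hp]; field_simp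
    exact_mod_cast h6

/-- Rounding the interval length costs g² variables, which is harmless exactly for g² ≤ w. For w ≤
g² the greedy cover is used: its loss 3w is absorbed by C(g+2,g) ≥ g²/2 from `choose_mul_choose_le`,
and 4374 = 6·729. -/
theorem exists_cover {w B : ℕ} (hg : 1 ≤ g) (hw : 2 * g ≤ w) (hwd : w ≤ d) (hB : g + 2 ≤ B)
    (h : d * g ≤ w * (B + 1)) :
    ∃ (s : ℕ) (F : Finset (Finset (Fin d))), (∀ S ∈ F, S.card ≤ s) ∧ g * s ≤ (g + 2) * w ∧
      (∀ X : Finset (Fin d), X.card ≤ g → ∃ S ∈ F, X ⊆ S) ∧ F.card ≤ 4374 * B.choose g := by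
  rcases le_total (g * g) w with hgg | hgg
  · obtain ⟨s, F, h1, h2, h3, h4⟩ := exists_cover_of_groups (d := d) (g := g) (by omega) (by omega)
      hgg h
    exact ⟨s, F, h1, h2, h3, by omega⟩
  · obtain ⟨F, h1, h2, h3⟩ := exists_cover_of_greedy hg (show g ≤ w by omega) hwd
    refine ⟨w, F, h1, Nat.mul_le_mul_right _ (by omega), h2, ?_⟩
    have h4 := choose_mul_choose_le hg hw hB hwd h
    have h5 : g * g ≤ 2 * (g + 2).choose g := by
      rw [Nat.choose_symm_add, Nat.choose_two_right]
      have : 2 ∣ (g + 2) * (g + 2 - 1) := (Nat.even_mul_pred_self _).two_dvd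
      rw [Nat.mul_div_cancel' this]
      exact Nat.mul_le_mul (by omega) (by omega)
    have hpos : 0 < g * g * w.choose g := Nat.mul_pos (by positivity) (Nat.choose_pos (by omega))
    refine Nat.le_of_mul_le_mul_right (c := g * g * w.choose g) ?_ hpos
    calc F.card * (g * g * w.choose g) = F.card * w.choose g * (g * g) := by ring
      _ ≤ 3 * w * d.choose g * (g * g) := Nat.mul_le_mul_right _ h3
      _ ≤ 3 * w * d.choose g * (2 * (g + 2).choose g) := Nat.mul_le_mul_left _ h5
      _ = 6 * w * (d.choose g * (g + 2).choose g) := by ring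
      _ ≤ 6 * w * (729 * (B.choose g * w.choose g)) := Nat.mul_le_mul_left _ h4
      _ ≤ 6 * (g * g) * (729 * (B.choose g * w.choose g)) :=
        Nat.mul_le_mul_right _ (Nat.mul_le_mul_left _ hgg)
      _ = 4374 * B.choose g * (g * g * w.choose g) := by ring

end Covering

/-! ### The main theorem -/

theorem exists_mem_ioCosts_le_of_eight_mul_le {n d g M w : ℕ} (hg : 1 ≤ g) (hn : tau g d ≤ n)
    (hw : 8 * g ≤ w) (hwd : w ≤ d) (hM : 4 * (w * tau g w) ≤ M) (hMd : 2000 * M ≤ d * tau g d) :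
    ∃ c ∈ ioCosts (attentionDAG n d g) M,
      c ≤ 883548 * (n * d * (d * g / w).choose g) := by
  have hw0 : 0 < w := by omega
  have hτ := succ_le_tau hg w
  have hwτ : 0 < w * tau g w := Nat.mul_pos hw0 (tau_pos g w)
  have hdg : d * g < w * (d * g / w + 1) := Nat.lt_mul_div_succ _ hw0
  -- Otherwise `d` exceeds `w` by a factor of at most 1 + 2/g, so d·τ(d) = O(w·τ(w)) = O(M), against
  -- `hMd`.
  have hB : g + 2 ≤ d * g / w := by
    by_contra hB
    have h1 : d * g ≤ w * (g + 2) := hdg.le.trans (Nat.mul_le_mul_left _ (by omega))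
    have h2 : tau g d ≤ 8 * tau g w := tau_le_of_mul_le hg (by linarith)
    have h3 : d ≤ 3 * w := by nlinarith
    have h4 : d * tau g d ≤ 3 * w * (8 * tau g w) := Nat.mul_le_mul h3 h2
    nlinarith
  obtain ⟨s, F, hs, hsw, hF, hFcard⟩ := exists_cover hg (by omega) hwd hB hdg.le
  have hsτ : tau g s ≤ 8 * tau g w := tau_le_of_mul_le hg hsw
  have hs3 : s ≤ 3 * w := by nlinarith
  -- As τ(s) ≤ 8τ(w), the block of H takes at most w·τ(w)/2 + 8τ(w) ≤ (3/2)·w·τ(w) of the 4·w·τ(w) ≤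
  -- M places; the last step needs w ≥ 8.
  set b := w / 16 + 1 with hb
  have hb1 : 16 * (w / 16) ≤ w := Nat.mul_div_le _ _
  have hb2 : w ≤ 16 * b := by omega
  have hbd : b ≤ d := by omega
  have hcap : tau g s * b + s + b + 3 ≤ M := by
    have h1 : tau g s * b ≤ 8 * tau g w * b := Nat.mul_le_mul_right _ hsτ
    have h2 : 2 * (8 * tau g w * b) ≤ w * tau g w + 16 * tau g w := by
      have := Nat.mul_le_mul_left (tau g w) hb1
      rw [hb]
      nlinarith
    have h3 : 8 * tau g w ≤ w * tau g w := Nat.mul_le_mul_right _ (by omega)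
    have h4 : w * (w + 1) ≤ w * tau g w := Nat.mul_le_mul_left _ hτ
    nlinarith
  obtain ⟨c, hc, hcost⟩ := exists_mem_ioCosts (n := n) (M := M) ((tau_pos g d).trans_le hn)
    (by omega) hg (Nat.le_add_left 1 _) F hs (fun a => hF _ a.card_support_le) hcap
  refine ⟨c, hc, hcost.trans ?_⟩
  have h1 : (d / b + 1) * (2 * s + 3 * b + 2) ≤ 202 * d := by
    have h2 : d / b * b ≤ d := Nat.div_mul_le_self _ _
    calc (d / b + 1) * (2 * s + 3 * b + 2) ≤ (d / b + 1) * (101 * b) :=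
          Nat.mul_le_mul_left _ (by omega)
      _ = 101 * (d / b * b + b) := by ring
      _ ≤ 202 * d := by omega
  calc F.card * (d / b + 1) * (n * (2 * s + 3 * b + 2))
      = F.card * (n * ((d / b + 1) * (2 * s + 3 * b + 2))) := by ring
    _ ≤ 4374 * (d * g / w).choose g * (n * (202 * d)) :=
        Nat.mul_le_mul hFcard (Nat.mul_le_mul_left _ h1)
    _ = _ := by ring

/-- For w < 8g the strategy for 8g is used instead. It fits because τ(8g) ≤ 2^(9g) is small against
M, and it is cheaper because ⌊dg/w⌋ decreases in `w`. -/
theorem exists_mem_ioCosts_le {n d g M w : ℕ} (hg : 1 ≤ g) (hn : tau g d ≤ n)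
    (hw : 1 ≤ w) (hwd : w ≤ d) (hM : 4 * (w * tau g w) ≤ M) (hMd : 2000 * M ≤ d * tau g d)
    (hgM : 2 ^ (20 * g) ≤ M) :
    ∃ c ∈ ioCosts (attentionDAG n d g) M,
      c ≤ 883548 * (n * d * (d * g / w).choose g) := by
  have h8 : 4 * (8 * g * tau g (8 * g)) ≤ M := by
    have h1 : tau g (8 * g) ≤ 2 ^ (9 * g) := by
      rw [tau, show 8 * g + g = 9 * g by ring]
      exact Nat.choose_le_two_pow _ _
    have h2 : g ≤ 2 ^ g := Nat.lt_two_pow_self.le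
    calc 4 * (8 * g * tau g (8 * g)) ≤ 4 * (8 * 2 ^ g * 2 ^ (9 * g)) :=
          Nat.mul_le_mul_left _ (Nat.mul_le_mul (Nat.mul_le_mul_left _ h2) h1)
      _ = 2 ^ (5 + 10 * g) := by
          rw [pow_add, show 10 * g = g + 9 * g by ring, pow_add]; ring
      _ ≤ 2 ^ (20 * g) := Nat.pow_le_pow_right (by norm_num) (by omega)
      _ ≤ M := hgM
  have hM0 : 0 < M := (pow_pos (by norm_num) _).trans_le hgM
  -- Otherwise d·τ(d) ≤ 8g·τ(8g) ≤ M/4, against `hMd`.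
  have h8d : 8 * g ≤ d := by
    by_contra h
    have := Nat.mul_le_mul (show d ≤ 8 * g by omega) (tau_mono g (show d ≤ 8 * g by omega))
    omega
  rcases le_total (8 * g) w with h | h
  · exact exists_mem_ioCosts_le_of_eight_mul_le hg hn h hwd hM hMd
  · obtain ⟨c, hc, hcost⟩ := exists_mem_ioCosts_le_of_eight_mul_le hg hn le_rfl h8d h8 hMd
    refine ⟨c, hc, hcost.trans (Nat.mul_le_mul_left _ (Nat.mul_le_mul_left _ ?_))⟩
    exact Nat.choose_le_choose g (Nat.div_le_div_left h hw)

theorem mainTheorem2 :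
    ∃ c C : ℝ, 0 < c ∧ 0 < C ∧
      ∀ (ι : Type) (l : Filter ι) (n d g M w : ι → ℕ),
        (fun x => (M x : ℝ)) =o[l] (fun x => (d x : ℝ) * (tau (g x) (d x) : ℝ)) →
        (fun x => (g x : ℝ)) =o[l] (fun x => Real.log (M x : ℝ)) →
        (∀ x, 1 ≤ g x) →
        (∀ x, tau (g x) (d x) ≤ n x) →
        (∀ x, g x ≤ w x ∧ w x ≤ d x) →
        (∀ x, (w x : ℝ) * (tau (g x) (w x) : ℝ) ≤ (1 / 4 : ℝ) * (M x : ℝ)) →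
        ∀ᶠ x in l, ∃ opt : ℕ,
          IsOptimalIOCost (attentionDAG (n x) (d x) (g x)) (M x) opt ∧
          (opt : ℝ) ≤ C * ((n x : ℝ) * (d x : ℝ) * ((d x * g x / w x).choose (g x) : ℝ)) ∧
          c * ((n x : ℝ) * (tau (g x) (d x) : ℝ) * (d x : ℝ) * (w x : ℝ) / (M x : ℝ)) ≤ (opt : ℝ)
      := by
  refine ⟨1 / 500, 883548, by norm_num, by norm_num, ?_⟩
  intro ι l n d g M w hMd hgM hg hn hw hM
  filter_upwards [hMd.bound (show (0 : ℝ) < 1 / 2000 by norm_num),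
    hgM.bound (show (0 : ℝ) < 1 / 20 by norm_num)] with x h1 h2
  have hMd' : 2000 * M x ≤ d x * tau (g x) (d x) := by
    rw [Real.norm_of_nonneg (by positivity), Real.norm_of_nonneg (by positivity)] at h1
    have h3 : (2000 : ℝ) * M x ≤ d x * tau (g x) (d x) := by linarith
    exact_mod_cast h3
  have hM' : 4 * (w x * tau (g x) (w x)) ≤ M x := by
    have h3 : (4 : ℝ) * (w x * tau (g x) (w x)) ≤ M x := by linarith [hM x]
    exact_mod_cast h3
  have hw1 : 1 ≤ w x := (hg x).trans (hw x).1
  have hM0 : 0 < M x := by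
    have := Nat.mul_pos hw1 (tau_pos (g x) (w x))
    omega
  have hM0' : (0 : ℝ) < M x := by exact_mod_cast hM0
  have hgM' : 2 ^ (20 * g x) ≤ M x := by
    rw [Real.norm_of_nonneg (by positivity),
      Real.norm_of_nonneg (Real.log_nonneg (by exact_mod_cast hM0))] at h2
    have h3 : (2 : ℝ) ^ (20 * g x) ≤ M x := by
      calc (2 : ℝ) ^ (20 * g x) ≤ Real.exp 1 ^ (20 * g x) :=
            pow_le_pow_left₀ (by norm_num) (by linarith [Real.exp_one_gt_d9]) _
        _ = Real.exp (20 * g x) := by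
            rw [← Real.exp_nat_mul]; push_cast; rw [mul_one]
        _ ≤ Real.exp (Real.log (M x)) := Real.exp_le_exp.2 (by linarith)
        _ = M x := Real.exp_log hM0'
    exact_mod_cast h3
  obtain ⟨c, hc, hcost⟩ := exists_mem_ioCosts_le (hg x) (hn x) hw1 (hw x).2 hM' hMd' hgM'
  have hne : (ioCosts (attentionDAG (n x) (d x) (g x)) (M x)).Nonempty := ⟨c, hc⟩
  -- The strategy of the upper bound shows that the set of costs is nonempty, so its infimum in ℕ is
  -- attained; on the empty set it would be the default value 0.
  refine ⟨sInf (ioCosts (attentionDAG (n x) (d x) (g x)) (M x)),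
    ⟨Nat.sInf_mem hne, fun c hc => Nat.sInf_le hc⟩, ?_, ?_⟩
  · exact_mod_cast (Nat.sInf_le hc).trans hcost
  · have h3 := le_cost_of_mem_ioCosts (hg x) (hn x) hw1 (hw x).2 hM' hMd' (Nat.sInf_mem hne)
    have h4 : (n x : ℝ) * tau (g x) (d x) * d x * w x ≤
        500 * (M x * (sInf (ioCosts (attentionDAG (n x) (d x) (g x)) (M x)) : ℕ)) := by
      exact_mod_cast h3
    rw [mul_div_assoc', div_le_iff₀ hM0']
    linarith
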